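/- Let $d\le 3$, let $e_1,\dots,e_d$ be a basis of $\mathbb R^d$, let $\Lambda=\mathbb Z e_1+\dots+\mathbb Z e_d$, and let $\mathcal H$ be a separable complex Hilbert space. Let $k\mapsto P(k)\in\mathcal B(\mathcal H)$, $k\in\mathbb R^d$, be a real-analytic family of orthogonal projectors of finite rank $m\ge 1$. A global Bloch frame for $P$ is a map $\Phi=(\phi_1,\dots,\phi_m)\colon\mathbb R^d\to\mathcal H^m$ such that for a.e. $k$ the vectors $\phi_1(k),\dots,\phi_m(k)$ form an orthonormal basis of $\operatorname{Ran}P(k)$. Write $k=\sum_j k_je_j$ and let $S\subset\mathbb R^d$ be the closed set, of codimension $2$, of the points $k$ at least two of whose coordinates $k_j$ are integers (so $S=\emptyset$ if $d\le1$, $S=\Lambda$ if $d=2$, and if $d=3$ then $S$ is the union of the lines through points of $\Lambda$ parallel to $e_1$, $e_2$ or $e_3$). (1) ($\tau$-covariant form.) Let $\tau\colon\Lambda\to\mathcal U(\mathcal H)$, $\lambda\mapsto\tau_\lambda$, be a unitary representation with $P(k+\lambda)=\tau_\lambda P(k)\tau_\lambda^{-1}$ for all $k\in\mathbb R^d$,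 $\lambda\in\Lambda$. Then there is a global Bloch frame $\Phi$ for $P$ such that (a) $\Phi$ is $\tau$-equivariant: $\phi_a(k+\lambda)=\tau_\lambda\phi_a(k)$ for all $k\in\mathbb R^d$, $\lambda\in\Lambda$, $a\in\{1,\dots,m\}$; (b) $\phi_a\in H^s_{\rm loc}(\mathbb R^d;\mathcal H)$ for all $0\le s<1$ and all $a$, i.e. $\phi_a\in L^2_{\rm loc}$ and, if $s>0$, $\iint_{K\times K}\frac{\|\phi_a(k)-\phi_a(k')\|^2}{|k-k'|^{d+2s}}\,dk\,dk'<\infty$ for every compact $K\subset\mathbb R^d$; (c) each $\phi_a$ is $C^\infty$ on $\mathbb R^d\setminus S$; if $d\ge2$, there is a constant $C$ with $\|\nabla\phi_a(k)\|\le C/\operatorname{dist}(k,S)$ for all $k\in\mathbb R^d\setminus S$ and all $a$ (for $d=2$ this reads $\|\nabla\phi_a(k)\|\le C/|k|$ for $k\neq0$ near $0$); and, if $d\ge2$, there is $r>0$ such that on $\{|k|<r\}\setminus S$ each $\phi_a$ is parallel along the rays issuing from the origin with respect to the Berry connection $\nabla^{\rm B}=P\nabla P+(1-P)\nabla(1-P)$,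 i.e. $(\nabla^{\rm B}_{k}\phi_a)(k)=0$ for the derivative at $k$ in the radial direction $k$. (2) (Periodic form.) If instead $P(k+\lambda)=P(k)$ for all $k\in\mathbb R^d$, $\lambda\in\Lambda$, then there is a global Bloch frame $\Phi$ for $P$ which is periodic, $\phi_a(k+\lambda)=\phi_a(k)$ for all $k,\lambda,a$, and satisfies (b) and (c). -/

import Mathlib

open MeasureTheory Module
open scoped ContDiff

namespace BlochFrames

/-- Momentum space `ℝ^d` with its Euclidean norm and Lebesgue measure. -/
abbrev Momentum (d : ℕ) : Type := EuclideanSpace ℝ (Fin d)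

/-- The lattice `Λ = ℤ e₁ + ⋯ + ℤ e_d` generated by a basis `b = (e₁, …, e_d)` of `ℝ^d`. -/
abbrev lattice {d : ℕ} (b : Basis (Fin d) ℝ (Momentum d)) : Submodule ℤ (Momentum d) :=
  Submodule.span ℤ (Set.range b)

section Families

variable {d : ℕ} {H : Type*} [NormedAddCommGroup H] [InnerProductSpace ℂ H] [CompleteSpace H]

/-- A unitary representation of the lattice on `H`. -/
abbrev LatticeRep (b : Basis (Fin d) ℝ (Momentum d)) (H : Type*) [NormedAddCommGroup H]
    [InnerProductSpace ℂ H] [CompleteSpace H] : Type _ :=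
  Multiplicative (lattice b) →* unitary (H →L[ℂ] H)

/-- The bounded operator `τ_l` on `H`, for a lattice vector `l`. -/
noncomputable def LatticeRep.op {b : Basis (Fin d) ℝ (Momentum d)} (τ : LatticeRep b H) (l : lattice b) :
    H →L[ℂ] H :=
  (τ (Multiplicative.ofAdd l) : H →L[ℂ] H)

/-- `τ`-covariance: `P (k + l) = τ_l P(k) τ_l⁻¹` (the inverse is taken in the unitary group). -/
def IsTauCovariant {b : Basis (Fin d) ℝ (Momentum d)} (τ : LatticeRep b H)
    (P : Momentum d → H →L[ℂ] H) : Prop :=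
  ∀ (k : Momentum d) (l : lattice b),
    P (k + (l : Momentum d)) =
      τ.op l * P k * (((τ (Multiplicative.ofAdd l))⁻¹ : unitary (H →L[ℂ] H)) : H →L[ℂ] H)

/-- `τ`-equivariance of a family of `m`-tuples of vectors. -/
def IsTauEquivariant {b : Basis (Fin d) ℝ (Momentum d)} (τ : LatticeRep b H) {m : ℕ}
    (Φ : Momentum d → Fin m → H) : Prop :=
  ∀ (k : Momentum d) (l : lattice b) (a : Fin m), Φ (k + (l : Momentum d)) a = τ.op l (Φ k a)

/-- Periodicity with respect to the lattice. -/
def IsLatticePeriodic {α : Type*} (b : Basis (Fin d) ℝ (Momentum d)) (f : Momentum d → α) : Prop :=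
  ∀ (k : Momentum d) (l : lattice b), f (k + (l : Momentum d)) = f k

/-- A global Bloch frame: for a.e. `k` the vectors `Φ k 0, …, Φ k (m-1)` form an orthonormal
basis of the range of `P k`. -/
def IsGlobalBlochFrame {m : ℕ} (P : Momentum d → H →L[ℂ] H) (Φ : Momentum d → Fin m → H) : Prop :=
  ∀ᵐ k : Momentum d,
    Orthonormal ℂ (Φ k) ∧
      Submodule.span ℂ (Set.range (Φ k)) = LinearMap.range (P k : H →ₗ[ℂ] H)

/-- The local fractional Sobolev space `H^s_loc(ℝ^d; H)` for `0 ≤ s < 1`: functions which are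
locally square integrable and, if `s > 0`, have finite Gagliardo seminorm
`∬_{K × K} ‖u(k) - u(k')‖² / |k - k'|^(d + 2s)` on every compact set `K`. -/
structure MemHsLoc (s : ℝ) (u : Momentum d → H) : Prop where
  aestronglyMeasurable : AEStronglyMeasurable u volume
  memLp_two : ∀ K : Set (Momentum d), IsCompact K → MemLp u 2 (volume.restrict K)
  gagliardo : 0 < s → ∀ K : Set (Momentum d), IsCompact K →
    (∫⁻ k in K, ∫⁻ k' in K,
      ENNReal.ofReal (‖u k - u k'‖ ^ 2 / ‖k - k'‖ ^ ((d : ℝ) + 2 * s))) < ⊤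

/-- The set of the points `k = ∑ⱼ kⱼ eⱼ` at least two of whose coordinates are integers, a closed
set of codimension two: it is empty for `d ≤ 1`, it is the lattice for `d = 2`, and for `d = 3` it
is the union of the lines through lattice points that are parallel to `e₁`, `e₂` or `e₃`. -/
def singularSet (b : Basis (Fin d) ℝ (Momentum d)) : Set (Momentum d) :=
  {k | ∃ i j : Fin d, i ≠ j ∧ (∃ p : ℤ, b.repr k i = p) ∧ ∃ q : ℤ, b.repr k j = q}

/-- The Berry connection `∇ᴮ = P ∘ ∇ ∘ P + P^⊥ ∘ ∇ ∘ P^⊥` applied to `φ`, at the point `k`, in the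
direction `v`. -/
noncomputable def berryDeriv (P : Momentum d → H →L[ℂ] H) (φ : Momentum d → H)
    (k v : Momentum d) : H :=
  P k (fderiv ℝ (fun x => P x (φ x)) k v) +
    (1 - P k) (fderiv ℝ (fun x => (1 - P x) (φ x)) k v)

/-- The frame is smooth off the codimension-two singular set; for `d ≥ 2` its gradient grows at
most like the inverse distance to that set, and near the origin (the centre of the unit cell) it is
parallel along the rays issuing from the origin, with respect to the Berry connection. -/
structure HasCodimTwoSingularities {m : ℕ} (b : Basis (Fin d) ℝ (Momentum d))
    (P : Momentum d → H →L[ℂ] H) (Φ : Momentum d → Fin m → H) : Prop where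
  smooth : ∀ a : Fin m, ContDiffOn ℝ ∞ (fun k => Φ k a) (singularSet b)ᶜ
  gradient_le : 2 ≤ d → ∃ C : ℝ, ∀ k ∉ singularSet b, ∀ a : Fin m,
    ‖fderiv ℝ (fun x => Φ x a) k‖ ≤ C / Metric.infDist k (singularSet b)
  radially_parallel : 2 ≤ d → ∃ r : ℝ, 0 < r ∧ ∀ k ∉ singularSet b, ‖k‖ < r → ∀ a : Fin m,
    berryDeriv P (fun x => Φ x a) k k = 0

end Families

end BlochFrames

namespace BlochFrames

/-! Over the contractible unit cell a smooth frame always exists: transport a basis of `Ran P(0)` by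
Kato's equation `U' = [∂P, P] U`. This transport is unitary, intertwines the projectors and commutes
with the lattice action (`exists_transport`). The frame `F` obtained this way need not match its
translates across opposite faces. On the pair of faces in direction `i` the mismatch is a map into
the unitaries commuting with `P 0`. On `Ran P(0)` it is joined to the identity by a smooth homotopy
`Γ i`, because the domain is contractible and `U(m)` is connected (`exists_transition`).

The mismatch is removed by twisting `F` near the upper face in direction `i` by `Γ i` at a cutoff
time, equal to `1` next to the interior of the face and to `0` farther away. Different faces cannot
be corrected simultaneously where they meet. The cutoffs are therefore functions of ratios, the
distance to the face being compared with the distance to its boundary. Their supports are then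
disjoint (`cutProd_disjoint`), so the twist is unitary. They are smooth off the points with two
integer coordinates, and their gradients are bounded by the inverse distance to those points
(`exists_hasFDerivAt_cut`). Extending equivariantly from the cell gives `frameOp`.

The same choice gives radial parallelism. Near a vertex the ratios are homogeneous of degree zero,
`F` is the transport issuing from that vertex, and `Γ` is evaluated at a locally constant point.
Along a ray from the origin the frame is thus the radial transport times a constant operator
(`frameOp_smul`), and `P [∂P, P] P = 0` is parallelism for the Berry connection.

Sobolev regularity uses only boundedness and the gradient estimate: interpolating between them gives
a Hölder bound with constant of order `dist(k, S)^(-σ)`, and `dist(k, S)^(-2σ)` is locally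
integrable for `σ < 1` because `S` has codimension two (`memHsLoc_of_fderiv_le`). -/

lemma contDiff_clm_apply {E F G : Type*} [NormedAddCommGroup E] [NormedSpace ℝ E]
    [NormedAddCommGroup F] [NormedSpace ℝ F] [NormedAddCommGroup G] [NormedSpace ℝ G]
    {n : WithTop ℕ∞} (L : F →L[ℝ] G) {f : E → F} (hf : ContDiff ℝ n f) :
    ContDiff ℝ n (fun x => L (f x)) :=
  L.contDiff.comp hf

/-! ### Smooth dependence of paths on parameters. -/

section ParametricPaths

open scoped unitInterval

/-- Evaluation of a path of linear maps at a vector, as a path of vectors. -/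
noncomputable def pathFlip (E' F : Type*) [NormedAddCommGroup E'] [NormedSpace ℝ E']
    [NormedAddCommGroup F] [NormedSpace ℝ F] : C(I, E' →L[ℝ] F) →L[ℝ] E' →L[ℝ] C(I, F) :=
  LinearMap.mkContinuous₂
    (LinearMap.mk₂ ℝ (fun (φ : C(I, E' →L[ℝ] F)) (h : E') =>
        (⟨fun t => φ t h, by fun_prop⟩ : C(I, F)))
      (by intros; ext; simp) (by intros; ext; simp) (by intros; ext; simp) (by intros; ext; simp))
    1 (by
      intro φ h
      rw [ContinuousMap.norm_le _ (by positivity)]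
      intro t
      simp only [LinearMap.mk₂_apply, ContinuousMap.coe_mk, one_mul]
      exact ((φ t).le_opNorm h).trans (by gcongr; exact φ.norm_coe_le_norm t))

/-- Continuity of `g'` in the sup norm makes the mean value estimate uniform in the time variable,
so pointwise derivatives assemble into a derivative in the space of paths. -/
lemma hasFDerivAt_path {E' F : Type*} [NormedAddCommGroup E'] [NormedSpace ℝ E']
    [NormedAddCommGroup F] [NormedSpace ℝ F] {g : E' → C(I, F)} {g' : E' → C(I, E' →L[ℝ] F)}
    (hg' : Continuous g') (hd : ∀ p t, HasFDerivAt (fun q => g q t) (g' p t) p) (p : E') :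
    HasFDerivAt g (pathFlip E' F (g' p)) p := by
  rw [hasFDerivAt_iff_isLittleO, Asymptotics.isLittleO_iff]
  intro ε hε
  obtain ⟨δ, hδ, hball⟩ := (Metric.continuous_iff (β := C(I, E' →L[ℝ] F))).mp hg' p ε hε
  filter_upwards [Metric.ball_mem_nhds p hδ] with q hq
  rw [ContinuousMap.norm_le _ (by positivity)]
  intro t
  refine Convex.norm_image_sub_le_of_norm_hasFDerivWithin_le' (s := Metric.ball p δ)
    (f := fun q => g q t) (f' := fun q => g' q t)
    (fun x _ => (hd x t).hasFDerivWithinAt) (fun x hx => ?_) (convex_ball p δ)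
    (Metric.mem_ball_self hδ) hq
  have h1 : ‖g' x - g' p‖ ≤ ε :=
    ((dist_eq_norm (E := C(I, E' →L[ℝ] F)) (g' x) (g' p)).symm.le).trans (hball x hx).le
  exact ((g' x - g' p).norm_coe_le_norm t).trans h1

universe u

/-- The derivative of `g` is again a family of paths of the same kind, with values in `E' →L[ℝ] F`.
The induction therefore varies `F`; taking `E'` in `Type` keeps this new target in the same
universe. -/
lemma contDiff_path_nat {E' : Type} [NormedAddCommGroup E'] [NormedSpace ℝ E'] (n : ℕ) :
    ∀ {F : Type u} [NormedAddCommGroup F] [NormedSpace ℝ F] {f : E' × ℝ → F} {g : E' → C(I, F)},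
      ContDiff ℝ ∞ f → (∀ p t, g p t = f (p, (t : ℝ))) → ContDiff ℝ n g := by
  induction n with
  | zero =>
    intro F _ _ f g hf hg
    have : g = (ContinuousMap.curry ⟨fun x : E' × I => f (x.1, (x.2 : ℝ)), by
        have := hf.continuous; fun_prop⟩ : C(E', C(I, F))) := by
      ext p t
      exact hg p t
    rw [Nat.cast_zero, contDiff_zero, this]
    exact ContinuousMap.continuous _
  | succ n ih =>
    intro F _ _ f g hf hg
    set f' : E' × ℝ → E' →L[ℝ] F := fun x => (fderiv ℝ f x).comp (ContinuousLinearMap.inl ℝ E' ℝ)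
      with hf'
    have hf's : ContDiff ℝ ∞ f' :=
      (hf.fderiv_right (m := ∞) le_rfl).clm_comp contDiff_const
    set g' : E' → C(I, E' →L[ℝ] F) := fun p =>
      ⟨fun t => f' (p, (t : ℝ)), by have := hf's.continuous; fun_prop⟩ with hg'
    have hg's : ContDiff ℝ n g' := ih hf's (fun p t => rfl)
    have : ((n + 1 : ℕ) : WithTop ℕ∞) = (n : WithTop ℕ∞) + 1 := by norm_cast
    rw [this, contDiff_succ_iff_hasFDerivAt]
    refine ⟨fun p => pathFlip E' F (g' p), contDiff_clm_apply (F := C(I, E' →L[ℝ] F))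
      (G := E' →L[ℝ] C(I, F)) (pathFlip E' F) hg's, fun p => ?_⟩
    refine hasFDerivAt_path hg's.continuous (fun p t => ?_) p
    have h1 : HasFDerivAt f (fderiv ℝ f (p, (t : ℝ))) (p, (t : ℝ)) :=
      ((hf.differentiable (by simp)) _).hasFDerivAt
    have h2 : HasFDerivAt (fun q : E' => (q, (t : ℝ))) (ContinuousLinearMap.inl ℝ E' ℝ) p :=
      hasFDerivAt_prodMk_left p (t : ℝ)
    have h3 := h1.comp p h2
    refine h3.congr_of_eventuallyEq (Filter.Eventually.of_forall fun q => ?_)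
    exact hg q t

lemma contDiff_path {E' : Type} [NormedAddCommGroup E'] [NormedSpace ℝ E']
    {F : Type u} [NormedAddCommGroup F] [NormedSpace ℝ F] {f : E' × ℝ → F} {g : E' → C(I, F)}
    (hf : ContDiff ℝ ∞ f) (hg : ∀ p t, g p t = f (p, (t : ℝ))) : ContDiff ℝ ∞ g :=
  contDiff_infty.mpr fun n => contDiff_path_nat n hf hg

end ParametricPaths

/-! ### Volterra operators and linear differential equations. -/

section Volterra

open scoped unitInterval

variable {A : Type*} [NormedRing A] [NormedAlgebra ℝ A] [CompleteSpace A]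

/-- The extension of a path on `[0, 1]` by constants. -/
noncomputable def extendPath {F : Type*} [TopologicalSpace F] (f : C(I, F)) : ℝ → F :=
  fun t => f (Set.projIcc 0 1 zero_le_one t)

lemma continuous_extendPath {F : Type*} [TopologicalSpace F] (f : C(I, F)) :
    Continuous (extendPath f) :=
  f.continuous.comp continuous_projIcc

lemma extendPath_of_mem {F : Type*} [TopologicalSpace F] (f : C(I, F)) {t : ℝ}
    (ht : t ∈ Set.Icc (0 : ℝ) 1) : extendPath f t = f ⟨t, ht⟩ := by
  simp [extendPath, Set.projIcc_of_mem _ ht]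

lemma hasDerivAt_integral_extendPath {F : Type*} [NormedAddCommGroup F] [NormedSpace ℝ F]
    [CompleteSpace F] (f : C(I, F)) (t : ℝ) :
    HasDerivAt (fun t => ∫ s in (0 : ℝ)..t, extendPath f s) (extendPath f t) t :=
  intervalIntegral.integral_hasDerivAt_right
    ((continuous_extendPath f).intervalIntegrable _ _)
    (continuous_extendPath f).stronglyMeasurable.stronglyMeasurableAtFilter
    (continuous_extendPath f).continuousAt

/-- Integration of paths. -/
noncomputable def integralPath (F : Type*) [NormedAddCommGroup F] [NormedSpace ℝ F]
    [CompleteSpace F] : C(I, F) →L[ℝ] C(I, F) :=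
  LinearMap.mkContinuous
    { toFun := fun f => ⟨fun t => ∫ s in (0 : ℝ)..t, extendPath f s, by
        have : Continuous (fun t => ∫ s in (0 : ℝ)..t, extendPath f s) :=
          continuous_iff_continuousAt.mpr fun t =>
            (hasDerivAt_integral_extendPath f t).continuousAt
        fun_prop⟩
      map_add' := fun f g => by
        ext t
        exact intervalIntegral.integral_add ((continuous_extendPath f).intervalIntegrable _ _)
          ((continuous_extendPath g).intervalIntegrable _ _)
      map_smul' := fun c f => by
        ext t
        exact intervalIntegral.integral_smul c _ }
    1 (by
      intro f
      rw [ContinuousMap.norm_le _ (by positivity)]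
      intro t
      have := intervalIntegral.norm_integral_le_of_norm_le_const (a := (0 : ℝ)) (b := t)
        (f := extendPath f) (C := ‖f‖) (fun x _ => f.norm_coe_le_norm _)
      refine this.trans ?_
      rw [sub_zero, abs_of_nonneg t.2.1, mul_comm]
      gcongr
      exact t.2.2)

/-- The Volterra operator `f ↦ ∫₀ᵗ a f`, depending linearly on the coefficient `a`. -/
noncomputable def volterra (A : Type*) [NormedRing A] [NormedAlgebra ℝ A] [CompleteSpace A] :
    C(I, A) →L[ℝ] C(I, A) →L[ℝ] C(I, A) :=
  (ContinuousLinearMap.compL ℝ C(I, A) C(I, A) C(I, A) (integralPath A)).comp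
    (ContinuousLinearMap.mul ℝ C(I, A))

lemma volterra_apply (a f : C(I, A)) (t : I) :
    volterra A a f t = ∫ s in (0 : ℝ)..t, extendPath (a * f) s := rfl

/-- Iterated integration over a simplex gains a factorial, so some power of the Volterra operator is
a contraction however large `a` is. -/
lemma norm_volterra_pow_apply_le (a f : C(I, A)) (n : ℕ) (t : I) :
    ‖((volterra A a) ^ n) f t‖ ≤ (‖a‖ * t) ^ n / n.factorial * ‖f‖ := by
  induction n generalizing t with
  | zero => simpa using f.norm_coe_le_norm t
  | succ n ih =>
    rw [pow_succ', mul_apply_eq_comp, volterra_apply]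
    have hb : ∀ s ∈ Set.Ioc (0 : ℝ) t,
        ‖extendPath (a * ((volterra A a) ^ n) f) s‖ ≤
          ‖a‖ ^ (n + 1) / n.factorial * ‖f‖ * s ^ n := by
      intro s hs
      have hs' : s ∈ Set.Icc (0 : ℝ) 1 := ⟨hs.1.le, hs.2.trans t.2.2⟩
      rw [extendPath_of_mem _ hs', ContinuousMap.mul_apply]
      calc _ ≤ ‖a ⟨s, hs'⟩‖ * ‖((volterra A a) ^ n) f ⟨s, hs'⟩‖ := norm_mul_le _ _
        _ ≤ ‖a‖ * ((‖a‖ * s) ^ n / n.factorial * ‖f‖) := by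
          gcongr
          · exact a.norm_coe_le_norm _
          · exact ih _
        _ = _ := by rw [mul_pow, pow_succ]; ring
    have h1 := intervalIntegral.norm_integral_le_of_norm_le (μ := volume) t.2.1
      (Filter.Eventually.of_forall hb)
      ((by fun_prop : Continuous fun s : ℝ =>
        ‖a‖ ^ (n + 1) / n.factorial * ‖f‖ * s ^ n).intervalIntegrable _ _)
    refine h1.trans (le_of_eq ?_)
    rw [intervalIntegral.integral_const_mul, integral_pow, Nat.factorial_succ, mul_pow]
    push_cast
    field_simp
    simp

/-- If `‖V ^ n‖ < 1` then `1 - V ^ n` is invertible; it is the product of the commuting factors `1 -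
V` and `1 + V + ⋯ + V ^ (n - 1)`, so `1 - V` is invertible too. -/
lemma isUnit_one_sub_volterra (a : C(I, A)) : IsUnit (1 - volterra A a) := by
  obtain ⟨n, hn⟩ := ((FloorSemiring.tendsto_pow_div_factorial_atTop ‖a‖).eventually
    (gt_mem_nhds (by norm_num : (0 : ℝ) < 1 / 2))).exists
  have hnorm : ‖(volterra A a) ^ n‖ < 1 := by
    refine lt_of_le_of_lt (ContinuousLinearMap.opNorm_le_bound _ (by norm_num : (0 : ℝ) ≤ 1 / 2)
      fun f => ?_) (by norm_num)
    rw [ContinuousMap.norm_le _ (by positivity)]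
    intro t
    refine (norm_volterra_pow_apply_le a f n t).trans ?_
    refine mul_le_mul_of_nonneg_right ?_ (norm_nonneg f)
    refine le_trans (?_ : _ ≤ ‖a‖ ^ n / n.factorial) hn.le
    gcongr ?_ ^ n / _
    · exact mul_nonneg (norm_nonneg a) t.2.1
    · exact mul_le_of_le_one_right (norm_nonneg a) t.2.2
  have h1 := isUnit_one_sub_of_norm_lt_one (R := C(I, A) →L[ℝ] C(I, A)) hnorm
  rw [← mul_neg_geom_sum] at h1
  refine ((Commute.isUnit_mul_iff ?_).mp h1).1
  rw [commute_iff_eq, mul_neg_geom_sum, geom_sum_mul_neg]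

end Volterra

/-- Solutions of linear differential equations depend smoothly on parameters. -/
theorem exists_linearODE_solution_contDiff {E' : Type} [NormedAddCommGroup E'] [NormedSpace ℝ E']
    {A : Type*} [NormedRing A] [NormedAlgebra ℝ A] [CompleteSpace A] {a : E' × ℝ → A}
    (ha : ContDiff ℝ ∞ a) :
    ∃ U : E' → ℝ → A, (∀ p, U p 0 = 1) ∧
      (∀ p, ∀ t ∈ Set.Icc (0 : ℝ) 1, HasDerivAt (U p) (a (p, t) * U p t) t) ∧
      ContDiff ℝ ∞ (fun p => U p 1) := by
  set g : E' → C(unitInterval, A) := fun p =>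
    ⟨fun t => a (p, (t : ℝ)), by have := ha.continuous; fun_prop⟩ with hg
  have hgs : ContDiff ℝ ∞ g := contDiff_path ha (fun p t => rfl)
  -- The equation in integral form is `W = 1 + ∫ a W`. Solving it by inversion of an operator
  -- reduces smoothness in `p` to smoothness of inversion.
  set W : E' → C(unitInterval, A) := fun p => Ring.inverse (1 - volterra A (g p)) 1 with hW
  have hWs : ContDiff ℝ ∞ W := by
    have h1 : ContDiff ℝ ∞ (fun p => 1 - volterra A (g p)) :=
      contDiff_const.sub (contDiff_clm_apply (F := C(unitInterval, A))
        (G := C(unitInterval, A) →L[ℝ] C(unitInterval, A)) (volterra A) hgs)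
    have h2 : ContDiff ℝ ∞ (fun p => Ring.inverse (1 - volterra A (g p))) := by
      rw [contDiff_iff_contDiffAt]
      intro p
      obtain ⟨w, hw⟩ := isUnit_one_sub_volterra (g p)
      have h3 := contDiffAt_ringInverse ℝ (R := C(unitInterval, A) →L[ℝ] C(unitInterval, A)) (n := ∞) w
      rw [hw] at h3
      exact h3.comp p h1.contDiffAt
    exact h2.clm_apply contDiff_const
  have hWeq : ∀ p, W p = 1 + volterra A (g p) (W p) := by
    intro p
    have h1 := Ring.mul_inverse_cancel _ (isUnit_one_sub_volterra (g p))
    have h2 := congrArg (fun L : C(unitInterval, A) →L[ℝ] C(unitInterval, A) => L 1) h1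
    simp only [mul_apply_eq_comp, one_apply_eq_self,
      sub_apply] at h2
    exact sub_eq_iff_eq_add.mp h2
  have hval : ∀ p, ∀ t (ht : t ∈ Set.Icc (0 : ℝ) 1),
      1 + ∫ s in (0 : ℝ)..t, extendPath (g p * W p) s = W p ⟨t, ht⟩ := by
    intro p t ht
    conv_rhs => rw [hWeq p]
    rfl
  -- Writing the solution as an integral of a function continuous on all of `ℝ` gives two-sided
  -- derivatives also at the endpoints `0` and `1`.
  refine ⟨fun p t => 1 + ∫ s in (0 : ℝ)..t, extendPath (g p * W p) s, fun p => by simp,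
    fun p t ht => ?_, ?_⟩
  · have h1 := (hasDerivAt_integral_extendPath (g p * W p) t).const_add 1
    simp only [hval p t ht]
    rw [extendPath_of_mem _ ht] at h1
    exact h1
  · have h1 : (fun p => 1 + ∫ s in (0 : ℝ)..1, extendPath (g p * W p) s) =
        fun p => W p ⟨1, by simp⟩ := by
      ext p
      exact hval p 1 (by simp)
    rw [h1]
    exact (ContinuousLinearMap.contDiff (E := C(unitInterval, A))
      (ContinuousMap.evalCLM ℝ (⟨1, by simp⟩ : unitInterval))).comp hWs

/-- Grönwall's inequality. Every algebraic identity for the transport is obtained by applying this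
to the difference of its two sides. -/
lemma linearODE_eq_zero {A : Type*} [NormedRing A] [NormedAlgebra ℝ A] {a b f f' : ℝ → A}
    (ha : Continuous a) (hb : Continuous b) (h0 : f 0 = 0)
    (hf : ∀ t ∈ Set.Icc (0 : ℝ) 1, HasDerivAt f (f' t) t)
    (he : ∀ t ∈ Set.Icc (0 : ℝ) 1, f' t = a t * f t + f t * b t) :
    ∀ t ∈ Set.Icc (0 : ℝ) 1, f t = 0 := by
  obtain ⟨C, hC⟩ := isCompact_Icc.exists_bound_of_continuousOn (s := Set.Icc (0 : ℝ) 1)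
    ha.continuousOn
  obtain ⟨D, hD⟩ := isCompact_Icc.exists_bound_of_continuousOn (s := Set.Icc (0 : ℝ) 1)
    hb.continuousOn
  refine eq_zero_of_abs_deriv_le_mul_abs_self_of_eq_zero_right (K := C + D)
    (f' := f')
    (fun t ht => (hf t ht).continuousAt.continuousWithinAt)
    (fun t ht => (hf t ⟨ht.1, ht.2.le⟩).hasDerivWithinAt) h0 (fun t ht => ?_)
  have ht' : t ∈ Set.Icc (0 : ℝ) 1 := ⟨ht.1, ht.2.le⟩
  rw [he t ht']
  calc ‖a t * f t + f t * b t‖ ≤ ‖a t‖ * ‖f t‖ + ‖f t‖ * ‖b t‖ :=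
        (norm_add_le _ _).trans (add_le_add (norm_mul_le _ _) (norm_mul_le _ _))
    _ ≤ C * ‖f t‖ + ‖f t‖ * D := by gcongr; exacts [hC t ht', hD t ht']
    _ = (C + D) * ‖f t‖ := by ring

/-! ### Kato's parallel transport. -/

section Transport

variable {V : Type} [NormedAddCommGroup V] [NormedSpace ℝ V]
  {H : Type*} [NormedAddCommGroup H] [InnerProductSpace ℂ H]

/-- The generator `[∂ᵥP, P]` of Kato's parallel transport. -/
noncomputable def katoGenerator (P : V → H →L[ℂ] H) (y v : V) : H →L[ℂ] H :=
  fderiv ℝ P y v * P y - P y * fderiv ℝ P y v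

lemma katoGenerator_smul (P : V → H →L[ℂ] H) (y v : V) (s : ℝ) :
    katoGenerator P y (s • v) = s • katoGenerator P y v := by
  simp [katoGenerator, smul_sub]

variable [CompleteSpace H] {P : V → H →L[ℂ] H}

lemma hasFDerivAt_of_contDiff {E F : Type*} [NormedAddCommGroup E] [NormedSpace ℝ E]
    [NormedAddCommGroup F] [NormedSpace ℝ F] {f : E → F} (hf : ContDiff ℝ ∞ f) (x : E) :
    HasFDerivAt f (fderiv ℝ f x) x :=
  (hf.differentiable (by simp) x).hasFDerivAt

lemma contDiff_katoGenerator (hP : ContDiff ℝ ∞ P) :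
    ContDiff ℝ ∞ (fun x : V × V => katoGenerator P x.1 x.2) := by
  have h1 : ContDiff ℝ ∞ (fun x : V × V => fderiv ℝ P x.1 x.2) :=
    ((hP.fderiv_right (m := ∞) le_rfl).comp contDiff_fst).clm_apply contDiff_snd
  have h2 : ContDiff ℝ ∞ (fun x : V × V => P x.1) := hP.comp contDiff_fst
  exact (h1.mul h2).sub (h2.mul h1)

lemma star_fderiv_projection (hP : ContDiff ℝ ∞ P) (hproj : ∀ k, IsStarProjection (P k))
    (y v : V) : star (fderiv ℝ P y v) = fderiv ℝ P y v := by
  have h1 := hasFDerivAt_of_contDiff hP y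
  have h2 : HasFDerivAt (fun x => star (P x)) _ y := h1.star
  have h3 : (fun x => star (P x)) = P := funext fun x => (hproj x).isSelfAdjoint.star_eq
  rw [h3] at h2
  have h4 := congrArg (fun L => L v) (h2.unique h1)
  exact h4

lemma fderiv_projection_eq (hP : ContDiff ℝ ∞ P) (hproj : ∀ k, IsStarProjection (P k))
    (y v : V) : fderiv ℝ P y v = P y * fderiv ℝ P y v + fderiv ℝ P y v * P y := by
  have h1 := hasFDerivAt_of_contDiff hP y
  have h2 := h1.mul' h1
  have h3 : (P * P) = P := funext fun x => (hproj x).isIdempotentElem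
  rw [h3] at h2
  have h4 := congrArg (fun L => L v) (h1.unique h2)
  simpa using h4

lemma star_katoGenerator (hP : ContDiff ℝ ∞ P) (hproj : ∀ k, IsStarProjection (P k))
    (y v : V) : star (katoGenerator P y v) = -katoGenerator P y v := by
  simp only [katoGenerator, star_sub, star_mul, star_fderiv_projection hP hproj,
    (hproj y).isSelfAdjoint.star_eq]
  abel

/-- The generator is off-diagonal with respect to `P`; this is why frames transported by it are
parallel for the Berry connection. -/
lemma projection_mul_katoGenerator_mul (hproj : ∀ k, IsStarProjection (P k)) (y v : V) :
    P y * katoGenerator P y v * P y = 0 := by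
  have h := (hproj y).isIdempotentElem
  have h' : P y * P y = P y := h
  rw [katoGenerator, mul_sub, sub_mul, ← mul_assoc, ← mul_assoc, h', mul_assoc, h', sub_self]

/-- Differentiating `P² = P` gives `P ∂P P = 0`, hence `[[∂P, P], P] = ∂P`. This is the
infinitesimal form of the intertwining relation of the transport with `P`. -/
lemma fderiv_projection_eq_commutator (hP : ContDiff ℝ ∞ P)
    (hproj : ∀ k, IsStarProjection (P k)) (y v : V) :
    fderiv ℝ P y v = katoGenerator P y v * P y - P y * katoGenerator P y v := by
  have h : P y * P y = P y := (hproj y).isIdempotentElem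
  have h1 := fderiv_projection_eq hP hproj y v
  set D := fderiv ℝ P y v
  have h2 : P y * D * P y = 0 := by
    have h3 := congrArg (fun x => P y * x * P y) h1
    simp only [mul_add, add_mul] at h3
    have e1 : P y * (P y * D) * P y = P y * D * P y := by rw [← mul_assoc, h]
    have e2 : P y * (D * P y) * P y = P y * D * P y := by simp only [mul_assoc, h]
    rw [e1, e2] at h3
    exact left_eq_add.mp h3
  have e3 : katoGenerator P y v * P y = D * P y := by
    change (D * P y - P y * D) * P y = _
    rw [sub_mul, h2, mul_assoc, h, sub_zero]
  have e4 : P y * katoGenerator P y v = - (P y * D) := by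
    change P y * (D * P y - P y * D) = _
    rw [mul_sub, ← mul_assoc, h2, ← mul_assoc, h, zero_sub]
  rw [e3, e4, sub_neg_eq_add, add_comm]
  exact h1

lemma katoGenerator_add_of_covariant (hP : ContDiff ℝ ∞ P) {l : V} {u : H →L[ℂ] H}
    (hu : u ∈ unitary (H →L[ℂ] H)) (hl : ∀ k, P (k + l) = u * P k * star u) (y v : V) :
    katoGenerator P (y + l) v * u = u * katoGenerator P y v := by
  have hu1 : star u * u = 1 := (Unitary.mem_iff.mp hu).1
  have hD : fderiv ℝ P (y + l) v = u * fderiv ℝ P y v * star u := by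
    have h1 : HasFDerivAt (fun k => P (k + l)) (fderiv ℝ P (y + l)) y :=
      (hasFDerivAt_of_contDiff hP (y + l)).comp y ((hasFDerivAt_id y).add_const l)
    have h2 := ((hasFDerivAt_of_contDiff hP y).const_mul u).mul_const' (star u)
    have h3 : (fun k => P (k + l)) = fun k => u * P k * star u := funext hl
    rw [h3] at h1
    exact congrArg (fun L : V →L[ℝ] H →L[ℂ] H => L v) (h1.unique h2)
  rw [katoGenerator, katoGenerator, hD, hl]
  have e1 : ∀ X Y : H →L[ℂ] H, u * X * star u * (u * Y * star u) * u = u * (X * Y) := by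
    intro X Y
    calc _ = u * X * (star u * u) * Y * (star u * u) := by simp only [mul_assoc]
      _ = _ := by rw [hu1]; simp only [mul_one, mul_assoc]
  rw [sub_mul, e1, e1, mul_sub]

/-- Kato's parallel transport `T (x, v)` along the segments from `x` to `x + v`. -/
theorem exists_transport (hP : ContDiff ℝ ∞ P) (hproj : ∀ k, IsStarProjection (P k)) :
    ∃ T : V × V → H →L[ℂ] H, ContDiff ℝ ∞ T ∧
      (∀ x, T (x, 0) = 1) ∧
      (∀ p, T p ∈ unitary (H →L[ℂ] H)) ∧
      (∀ x v, T (x, v) * P x = P (x + v) * T (x, v)) ∧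
      (∀ (l : V) (u : H →L[ℂ] H), u ∈ unitary (H →L[ℂ] H) →
        (∀ k, P (k + l) = u * P k * star u) → ∀ x v, T (x + l, v) * u = u * T (x, v)) ∧
      (∀ x v, ∀ t ∈ Set.Ioo (0 : ℝ) 1, HasDerivAt (fun s : ℝ => T (x, s • v))
        (katoGenerator P (x + t • v) v * T (x, t • v)) t) := by
  set a : (V × V) × ℝ → H →L[ℂ] H := fun q => katoGenerator P (q.1.1 + q.2 • q.1.2) q.1.2 with ha
  have has : ContDiff ℝ ∞ a := by
    have : ContDiff ℝ ∞ (fun q : (V × V) × ℝ => (q.1.1 + q.2 • q.1.2, q.1.2)) := by fun_prop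
    exact (contDiff_katoGenerator hP).comp this
  obtain ⟨U, hU0, hU, hUs⟩ := exists_linearODE_solution_contDiff has
  have hac : ∀ p, Continuous fun t => a (p, t) := fun p => has.continuous.comp (by fun_prop)
  have hone : (1 : ℝ) ∈ Set.Icc (0 : ℝ) 1 := by simp
  have hskew : ∀ q, star (a q) = -a q := fun q => star_katoGenerator hP hproj _ _
  have hUstar : ∀ p, ∀ t ∈ Set.Icc (0 : ℝ) 1,
      HasDerivAt (fun t => star (U p t)) (-(star (U p t) * a (p, t))) t := by
    intro p t ht
    have := (hU p t ht).star
    rwa [star_mul, hskew, mul_neg] at this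
  have hunit1 : ∀ p, ∀ t ∈ Set.Icc (0 : ℝ) 1, star (U p t) * U p t - 1 = 0 := by
    intro p
    refine linearODE_eq_zero (a := fun _ => 0) (b := fun _ => 0) continuous_const continuous_const
      (by simp [hU0])
      (fun t ht => ((hUstar p t ht).mul (hU p t ht)).sub_const (1 : H →L[ℂ] H)) (fun t ht => ?_)
    simp [mul_assoc]
  -- In infinite dimension an isometry need not be unitary, so `U U* = 1` needs its own equation `f'
  -- = a f - f a`.
  have hunit2 : ∀ p, ∀ t ∈ Set.Icc (0 : ℝ) 1, U p t * star (U p t) - 1 = 0 := by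
    intro p
    refine linearODE_eq_zero (hac p) (hac p).neg (by simp [hU0])
      (fun t ht => ((hU p t ht).mul (hUstar p t ht)).sub_const (1 : H →L[ℂ] H)) (fun t ht => ?_)
    simp only [mul_sub, sub_mul, mul_assoc, mul_neg, Pi.neg_apply]
    simp only [mul_one, one_mul]
    abel
  have hline : ∀ (x v : V) (t : ℝ), HasDerivAt (fun t : ℝ => P (x + t • v))
      (fderiv ℝ P (x + t • v) v) t := by
    intro x v t
    have h1 : HasDerivAt (fun t : ℝ => x + t • v) v t := by
      simpa using ((hasDerivAt_id t).smul_const v).const_add x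
    exact (hasFDerivAt_of_contDiff hP _).comp_hasDerivAt t h1
  have hint : ∀ x v, ∀ t ∈ Set.Icc (0 : ℝ) 1,
      P (x + t • v) * U (x, v) t - U (x, v) t * P x = 0 := by
    intro x v
    refine linearODE_eq_zero (hac (x, v)) (b := fun _ => 0) continuous_const
      (by simp [hU0])
      (fun t ht => ((hline x v t).mul (hU (x, v) t ht)).sub ((hU (x, v) t ht).mul_const (P x)))
      (fun t ht => ?_)
    have h1 := fderiv_projection_eq_commutator hP hproj (x + t • v) v
    simp only [ha]
    rw [h1]
    simp only [mul_sub, sub_mul, mul_assoc, mul_zero]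
    abel
  have hequiv : ∀ (l : V) (u : H →L[ℂ] H), u ∈ unitary (H →L[ℂ] H) →
      (∀ k, P (k + l) = u * P k * star u) → ∀ x v, ∀ t ∈ Set.Icc (0 : ℝ) 1,
        U (x + l, v) t * u - u * U (x, v) t = 0 := by
    intro l u hu hl x v
    refine linearODE_eq_zero (hac (x + l, v)) (b := fun _ => 0) continuous_const
      (by simp [hU0])
      (fun t ht => ((hU (x + l, v) t ht).mul_const u).sub ((hU (x, v) t ht).const_mul u))
      (fun t ht => ?_)
    have h1 := katoGenerator_add_of_covariant hP hu hl (x + t • v) v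
    rw [show x + t • v + l = x + l + t • v by abel] at h1
    simp only [ha]
    simp only [mul_sub, mul_zero, add_zero, ← mul_assoc, h1]
  -- Time can be rescaled: the time-one transport along `s • v` is the time-`s` transport along `v`.
  -- This turns the differential equation in time into one along rays for the time-one map `T`.
  have hscale : ∀ x v, ∀ s ∈ Set.Icc (0 : ℝ) 1, U (x, s • v) 1 = U (x, v) s := by
    intro x v s hs
    have h2 : ∀ t ∈ Set.Icc (0 : ℝ) 1, U (x, s • v) t - U (x, v) (t * s) = 0 := by
      refine linearODE_eq_zero (hac (x, s • v)) (b := fun _ => 0) continuous_const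
        (by simp [hU0]) (f' := fun t => a ((x, s • v), t) * U (x, s • v) t -
          ((1 : ℝ) * s) • (a ((x, v), t * s) * U (x, v) (t * s))) (fun t ht => ?_) (fun t ht => ?_)
      · have h3 : t * s ∈ Set.Icc (0 : ℝ) 1 :=
          ⟨mul_nonneg ht.1 hs.1, mul_le_one₀ ht.2 hs.1 hs.2⟩
        have h4 : HasDerivAt (fun t => U (x, v) (t * s)) _ t :=
          (hU (x, v) (t * s) h3).scomp t ((hasDerivAt_id t).mul_const s)
        exact (hU (x, s • v) t ht).sub h4
      · simp only [ha, smul_smul, katoGenerator_smul, mul_sub, mul_zero, add_zero, smul_mul_assoc,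
          one_mul]
    have := h2 1 hone
    rw [one_mul] at this
    exact sub_eq_zero.mp this
  refine ⟨fun p => U p 1, hUs, fun x => ?_, fun p => ?_, fun x v => ?_, fun l u hu hl x v => ?_,
    fun x v t ht => ?_⟩
  · have := hscale x 0 0 (by simp)
    rw [smul_zero] at this
    exact this.trans (hU0 _)
  · exact Unitary.mem_iff.mpr
      ⟨sub_eq_zero.mp (hunit1 p 1 hone), sub_eq_zero.mp (hunit2 p 1 hone)⟩
  · have := hint x v 1 hone
    rw [one_smul] at this
    exact (sub_eq_zero.mp this).symm
  · exact sub_eq_zero.mp (hequiv l u hu hl x v 1 hone)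
  · have ht' : t ∈ Set.Icc (0 : ℝ) 1 := ⟨ht.1.le, ht.2.le⟩
    have h1 := hU (x, v) t ht'
    simp only [hscale x v t ht']
    refine h1.congr_of_eventuallyEq ?_
    filter_upwards [Icc_mem_nhds ht.1 ht.2] with s hs
    exact hscale x v s hs

end Transport

/-! ### Connecting unitaries smoothly to the identity. -/

/-- The finite spectrum omits some `-y` on the unit circle. After rotation by `y⁻¹` the principal
logarithm applies, and the path is the exponential of a real line of self-adjoint elements. -/
lemma exists_smooth_unitary_path {A : Type*} [CStarAlgebra A] {u : A} (hu : u ∈ unitary A)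
    (hfin : (spectrum ℂ u).Finite) :
    ∃ γ : ℝ → A, ContDiff ℝ ∞ γ ∧ (∀ s, γ s ∈ unitary A) ∧ γ 0 = 1 ∧ γ 1 = u := by
  have hinf : Infinite Circle := by
    have : Infinite (Set.Ioc (-Real.pi) Real.pi) :=
      Set.Infinite.to_subtype (Set.Ioc_infinite (by linarith [Real.pi_pos]))
    exact Circle.argEquiv.infinite_iff.mpr this
  obtain ⟨y, hy⟩ : ∃ y : Circle, -(y : ℂ) ∉ spectrum ℂ u := by
    by_contra! h
    refine Set.infinite_range_of_injective (f := fun y : Circle => -(y : ℂ)) ?_ (hfin.subset ?_)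
    · intro a b hab
      exact Circle.ext (neg_injective hab)
    · rintro _ ⟨y, rfl⟩
      exact h y
  have hyn : star (y : ℂ) * (y : ℂ) = 1 := by
    rw [Complex.star_def, ← Complex.normSq_eq_conj_mul_self]; simp
  set v : A := ((y⁻¹ : Circle) : ℂ) • u with hv
  have hvu : v ∈ unitary A := by
    rw [Unitary.mem_iff] at hu ⊢
    rw [hv, star_smul, smul_mul_smul_comm, smul_mul_smul_comm, hu.1, hu.2, Circle.coe_inv_eq_conj,
      ← Complex.star_def, star_star, hyn, mul_comm, hyn, one_smul]
    exact ⟨rfl, rfl⟩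
  have hspec : (-1 : ℂ) ∉ spectrum ℂ v := by
    set r : ℂˣ := Units.mk0 ((y⁻¹ : Circle) : ℂ) (Circle.coe_ne_zero _) with hr
    have h1 : (-1 : ℂ) = r • (-(y : ℂ)) := by
      rw [Units.smul_def, hr, Units.val_mk0, smul_eq_mul, mul_neg, ← Circle.coe_mul]
      simp
    have h2 : v = r • u := rfl
    rw [h1, h2, spectrum.unit_smul_eq_smul, Set.smul_mem_smul_set_iff]
    exact hy
  have hnorm := (Unitary.norm_sub_one_lt_two_iff hvu).mpr hspec
  set a : selfAdjoint A := Unitary.argSelfAdjoint ⟨v, hvu⟩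
  have hexp : NormedSpace.exp (Complex.I • (a : A)) = v := by
    have := congrArg Subtype.val (expUnitary_argSelfAdjoint (u := ⟨v, hvu⟩) hnorm)
    rwa [selfAdjoint.expUnitary_coe] at this
  -- Adding the scalar `arg y` undoes the rotation.
  set c : selfAdjoint A := a + (Complex.arg y : ℝ) • 1 with hc
  refine ⟨fun s => selfAdjoint.expUnitary (s • c), ?_, fun s => Subtype.property _, ?_, ?_⟩
  · have h1 : ContDiff ℝ ∞ (fun s : ℝ => NormedSpace.exp (s • (Complex.I • (c : A)))) := by
      have h2 : ContDiff ℝ ∞ (NormedSpace.exp : A → A) :=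
        contDiff_iff_contDiffAt.mpr fun x => (NormedSpace.exp_analytic (𝕂 := ℝ) x).contDiffAt
      exact h2.comp (contDiff_id.smul contDiff_const)
    convert h1 using 2 with s
    rw [selfAdjoint.expUnitary_coe, selfAdjoint.val_smul, smul_comm]
  · simp
  · let _ : NormedAlgebra ℚ A := NormedAlgebra.restrictScalars ℚ ℂ A
    simp only [one_smul]
    rw [selfAdjoint.expUnitary_coe, hc, AddSubgroup.coe_add, selfAdjoint.val_smul,
      smul_add, NormedSpace.exp_add_of_commute, hexp]
    · have h1 : NormedSpace.exp (Complex.I • ((Complex.arg y : ℝ) • ((1 : selfAdjoint A) : A))) =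
          (y : ℂ) • (1 : A) := by
        have h2 : Complex.I • ((Complex.arg y : ℝ) • ((1 : selfAdjoint A) : A)) =
            algebraMap ℂ A ((Complex.arg y : ℂ) * Complex.I) := by
          rw [Algebra.algebraMap_eq_smul_one, mul_comm, mul_smul]
          rfl
        rw [h2, ← NormedSpace.algebraMap_exp_comm, Algebra.algebraMap_eq_smul_one,
          ← Complex.exp_eq_exp_ℂ, ← Circle.coe_exp, Circle.exp_arg]
      rw [h1, mul_smul_comm, mul_one, hv, smul_smul, ← Circle.coe_mul]
      simp
    · refine Commute.smul_left (Commute.smul_right ?_ _) _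
      exact Commute.smul_right (Commute.one_right _) _

/-- On the range of a finite-rank projection, written as `J J†` for an isometry `J`, a unitary
commuting with the projection can be joined smoothly to the identity. -/
lemma exists_smooth_unitary_path_of_isometry {S H : Type*} [NormedAddCommGroup S]
    [InnerProductSpace ℂ S] [CompleteSpace S] [FiniteDimensional ℂ S] [NormedAddCommGroup H]
    [InnerProductSpace ℂ H] [CompleteSpace H] {Q u : H →L[ℂ] H} (hQ : IsStarProjection Q)
    {J : S →L[ℂ] H} (hKJ : (ContinuousLinearMap.adjoint J) ∘L J = 1)
    (hJK : J ∘L (ContinuousLinearMap.adjoint J) = Q)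
    (hu : u ∈ unitary (H →L[ℂ] H)) (hcomm : Commute u Q) :
    ∃ γ : ℝ → H →L[ℂ] H, ContDiff ℝ ∞ γ ∧ (∀ s, γ s ∈ unitary (H →L[ℂ] H)) ∧
      (∀ s, Commute (γ s) Q) ∧ γ 0 = 1 ∧ γ 1 * Q = u * Q := by
  set K : H →L[ℂ] S := ContinuousLinearMap.adjoint J with hK
  have hQQ : Q * Q = Q := hQ.isIdempotentElem
  set ι : (S →L[ℂ] S) → H →L[ℂ] H := fun T => J ∘L T ∘L K with hι
  have hιmul : ∀ T T', ι T * ι T' = ι (T * T') := by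
    intro T T'
    ext x
    have := congrArg (fun L => L (T' (K x))) hKJ
    simp only [ContinuousLinearMap.comp_apply, one_apply_eq_self] at this
    simp [hι, mul_apply_eq_comp, this]
  have hιstar : ∀ T, star (ι T) = ι (star T) := by
    intro T
    simp only [hι, ContinuousLinearMap.star_eq_adjoint, ContinuousLinearMap.adjoint_comp, hK,
      ContinuousLinearMap.adjoint_adjoint, ContinuousLinearMap.comp_assoc]
  have hι1 : ι 1 = Q := by
    rw [← hJK]; rfl
  have hιQ : ∀ T, ι T * Q = ι T := fun T => by rw [← hι1, hιmul, mul_one]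
  have hQι : ∀ T, Q * ι T = ι T := fun T => by rw [← hι1, hιmul, one_mul]
  set w : S →L[ℂ] S := K ∘L u ∘L J with hw
  have hιw : ι w = u * Q := by
    have : ι w = Q * u * Q := by
      rw [← hJK]; rfl
    rw [this, ← hcomm.eq, mul_assoc, hQQ]
  have hu1 := Unitary.mem_iff.mp hu
  have hcomm' : Commute (star u) Q := by
    have := hcomm.star_star
    rwa [hQ.isSelfAdjoint.star_eq] at this
  have hιinj : Function.Injective ι := by
    intro T T' h
    have h1 : ∀ T, K ∘L ι T ∘L J = T := by
      intro T
      ext x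
      have h2 : ∀ z, K (J z) = z := fun z => congrArg (fun L => L z) hKJ
      simp [hι, h2]
    rw [← h1 T, ← h1 T', h]
  have hwu : w ∈ unitary (S →L[ℂ] S) := by
    rw [Unitary.mem_iff]
    constructor <;> apply hιinj <;> rw [← hιmul, ← hιstar, hιw, hι1, star_mul,
      hQ.isSelfAdjoint.star_eq]
    · rw [mul_assoc, ← mul_assoc (star u), hu1.1, one_mul, hQQ]
    · rw [mul_assoc, ← mul_assoc Q, hQQ, ← hcomm'.eq, ← mul_assoc, hu1.2, one_mul]
  have hfin : (spectrum ℂ w).Finite := by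
    have h1 := Module.End.finite_spectrum ((Module.End.toContinuousLinearMap S).symm w)
    rwa [AlgEquiv.spectrum_eq] at h1
  obtain ⟨g, hgs, hgu, hg0, hg1⟩ := exists_smooth_unitary_path hwu hfin
  have hιs : ContDiff ℝ ∞ (fun s => ι (g s)) := by
    have h1 : IsBoundedLinearMap ℝ ι := by
      refine IsLinearMap.with_bound ⟨fun x y => ?_, fun c x => ?_⟩ (‖J‖ * ‖K‖) (fun x => ?_)
      · ext; simp [hι]
      · ext; simp [hι]
      · calc _ ≤ ‖J‖ * ‖x ∘L K‖ := ContinuousLinearMap.opNorm_comp_le _ _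
          _ ≤ ‖J‖ * (‖x‖ * ‖K‖) := by gcongr; exact ContinuousLinearMap.opNorm_comp_le _ _
          _ = _ := by ring
    exact h1.contDiff.comp hgs
  -- The path acts as the identity on the complement of the range of `Q`, so its endpoint agrees
  -- with `u` only after multiplication by `Q`.
  refine ⟨fun s => ι (g s) + (1 - Q), hιs.add contDiff_const, fun s => ?_, fun s => ?_, ?_, ?_⟩
  · have h2 := Unitary.mem_iff.mp (hgu s)
    have hQ1 : Q * (1 - Q) = 0 := by rw [mul_sub, mul_one, hQQ, sub_self]
    have hQ2 : (1 - Q) * Q = 0 := by rw [sub_mul, one_mul, hQQ, sub_self]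
    have hQ3 : (1 - Q) * (1 - Q) = 1 - Q := by rw [mul_sub, hQ2, sub_zero, mul_one]
    have e1 : ∀ T, ι T * (1 - Q) = 0 := fun T => by rw [← hιQ, mul_assoc, hQ1, mul_zero]
    have e2 : ∀ T, (1 - Q) * ι T = 0 := fun T => by rw [← hQι, ← mul_assoc, hQ2, zero_mul]
    rw [Unitary.mem_iff, star_add, star_sub, star_one, hQ.isSelfAdjoint.star_eq, hιstar]
    constructor
    · rw [add_mul, mul_add, mul_add, e1, e2, hQ3, hιmul, h2.1, hι1]; abel
    · rw [add_mul, mul_add, mul_add, e1, e2, hQ3, hιmul, h2.2, hι1]; abel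
  · rw [commute_iff_eq, add_mul, mul_add, hιQ, hQι, sub_mul, mul_sub, one_mul, mul_one]
  · simp only [hg0, hι1]; abel
  · simp only [hg1]
    rw [ hιw, add_mul, mul_assoc, hQQ, sub_mul, one_mul, hQQ]; abel

/-- On the range of a finite-rank projection, a unitary commuting with the projection can be
joined smoothly to the identity. -/
lemma exists_smooth_unitary_path_on_range {H : Type*} [NormedAddCommGroup H]
    [InnerProductSpace ℂ H] [CompleteSpace H] {Q u : H →L[ℂ] H} (hQ : IsStarProjection Q)
    [FiniteDimensional ℂ (LinearMap.range (Q : H →ₗ[ℂ] H))]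
    (hu : u ∈ unitary (H →L[ℂ] H)) (hcomm : Commute u Q) :
    ∃ γ : ℝ → H →L[ℂ] H, ContDiff ℝ ∞ γ ∧ (∀ s, γ s ∈ unitary (H →L[ℂ] H)) ∧
      (∀ s, Commute (γ s) Q) ∧ γ 0 = 1 ∧ γ 1 * Q = u * Q := by
  have : CompleteSpace (LinearMap.range (Q : H →ₗ[ℂ] H)) := FiniteDimensional.complete ℂ _
  refine exists_smooth_unitary_path_of_isometry hQ
    (J := (LinearMap.range (Q : H →ₗ[ℂ] H)).subtypeL) ?_ ?_ hu hcomm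
  · rw [Submodule.adjoint_subtypeL]
    ext x
    simp
  · rw [Submodule.adjoint_subtypeL]
    exact (isStarProjection_iff_eq_starProjection_range.mp hQ).choose_spec.symm

/-! ### One-variable cutoffs. -/

section Cutoffs

/-- A smooth step, `0` on `(-∞, 1/3]` and `1` on `[2/3, ∞)`. -/
noncomputable def smoothStep (t : ℝ) : ℝ := Real.smoothTransition (3 * t - 1)

lemma contDiff_smoothStep : ContDiff ℝ ∞ smoothStep :=
  Real.smoothTransition.contDiff.comp (by fun_prop)

lemma smoothStep_of_le {t : ℝ} (ht : t ≤ 1 / 3) : smoothStep t = 0 :=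
  Real.smoothTransition.zero_of_nonpos (by linarith)

lemma smoothStep_of_ge {t : ℝ} (ht : 2 / 3 ≤ t) : smoothStep t = 1 :=
  Real.smoothTransition.one_of_one_le (by linarith)

lemma smoothStep_nonneg (t : ℝ) : 0 ≤ smoothStep t := Real.smoothTransition.nonneg _

lemma smoothStep_le_one (t : ℝ) : smoothStep t ≤ 1 := Real.smoothTransition.le_one _

/-- A smoothed distance of `t ∈ [0, 1]` to `{0, 1}`. -/
noncomputable def endDist (t : ℝ) : ℝ := (1 - smoothStep t) * t + smoothStep t * (1 - t)

lemma contDiff_endDist : ContDiff ℝ ∞ endDist := by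
  have := contDiff_smoothStep
  unfold endDist
  fun_prop

lemma endDist_of_le {t : ℝ} (ht : t ≤ 1 / 3) : endDist t = t := by
  simp [endDist, smoothStep_of_le ht]

lemma endDist_of_ge {t : ℝ} (ht : 2 / 3 ≤ t) : endDist t = 1 - t := by
  simp [endDist, smoothStep_of_ge ht]

lemma min_le_endDist (t : ℝ) : min t (1 - t) ≤ endDist t := by
  have h0 := smoothStep_nonneg t
  have h1 := smoothStep_le_one t
  have := min_le_left t (1 - t)
  have := min_le_right t (1 - t)
  unfold endDist
  nlinarith

/-- The constant `2` here, against the threshold `4` in `ratioCutoff`, makes the supports of the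
face cutoffs disjoint. -/
lemma endDist_le {t : ℝ} (h1 : t ≤ 1) : endDist t ≤ 2 * (1 - t) := by
  rcases le_total t (1 / 3) with h | h
  · rw [endDist_of_le h]; linarith
  rcases le_total t (2 / 3) with h' | h'
  · have h2 := smoothStep_nonneg t
    have h3 := smoothStep_le_one t
    unfold endDist
    nlinarith
  · rw [endDist_of_ge h']; linarith

lemma endDist_pos {t : ℝ} (h0 : 0 < t) (h1 : t < 1) : 0 < endDist t :=
  lt_of_lt_of_le (lt_min h0 (by linarith)) (min_le_endDist t)

/-- A smooth cutoff, `0` on `(-∞, 4]` and `1` on `[8, ∞)`. -/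
noncomputable def ratioCutoff (x : ℝ) : ℝ := Real.smoothTransition ((x - 4) / 4)

lemma contDiff_ratioCutoff : ContDiff ℝ ∞ ratioCutoff :=
  Real.smoothTransition.contDiff.comp (by fun_prop)

lemma ratioCutoff_of_le {x : ℝ} (hx : x ≤ 4) : ratioCutoff x = 0 :=
  Real.smoothTransition.zero_of_nonpos (by linarith)

lemma ratioCutoff_of_ge {x : ℝ} (hx : 8 ≤ x) : ratioCutoff x = 1 :=
  Real.smoothTransition.one_of_one_le (by linarith)

lemma ratioCutoff_nonneg (x : ℝ) : 0 ≤ ratioCutoff x := Real.smoothTransition.nonneg _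

lemma ratioCutoff_le_one (x : ℝ) : ratioCutoff x ≤ 1 := Real.smoothTransition.le_one _

end Cutoffs

/-! ### Transition unitaries and their homotopies. -/

section Transition

variable {V : Type} [NormedAddCommGroup V] [NormedSpace ℝ V]
  {H : Type*} [NormedAddCommGroup H] [InnerProductSpace ℂ H] [CompleteSpace H]
  {P : V → H →L[ℂ] H}

lemma contDiff_star {f : V → H →L[ℂ] H} (hf : ContDiff ℝ ∞ f) :
    ContDiff ℝ ∞ (fun x => star (f x)) :=
  contDiff_clm_apply ((starL' ℝ : (H →L[ℂ] H) ≃L[ℝ] (H →L[ℂ] H)) : (H →L[ℂ] H) →L[ℝ] (H →L[ℂ] H))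
    hf

/-- The transition unitaries between a radial frame and its translate, together with a smooth
homotopy to the identity. -/
lemma exists_transition (hproj : ∀ k, IsStarProjection (P k))
    [FiniteDimensional ℂ (LinearMap.range (P 0 : H →ₗ[ℂ] H))]
    {R : V → H →L[ℂ] H} (hR : ContDiff ℝ ∞ R) (hRu : ∀ y, R y ∈ unitary (H →L[ℂ] H))
    (hRP : ∀ y, R y * P 0 = P y * R y) {l : V} {u : H →L[ℂ] H} (hu : u ∈ unitary (H →L[ℂ] H))
    (hl : ∀ k, P (k + l) = u * P k * star u) :
    ∃ Γ : ℝ × V → H →L[ℂ] H, ContDiff ℝ ∞ Γ ∧ (∀ p, Γ p ∈ unitary (H →L[ℂ] H)) ∧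
      (∀ p, Commute (Γ p) (P 0)) ∧ (∀ y, Γ (0, y) = 1) ∧
      ∀ y, u * R (y - l) * Γ (1, y) * P 0 = R y * P 0 := by
  -- `γ y` is chosen so that `u * R (y - l) * γ y = R y`; it commutes with `P 0` by the intertwining
  -- and covariance relations.
  set γ : V → H →L[ℂ] H := fun y => star (R (y - l)) * star u * R y with hγ
  have hγs : ContDiff ℝ ∞ γ := by
    have h1 : ContDiff ℝ ∞ (fun y => R (y - l)) := hR.comp (contDiff_id.sub contDiff_const)
    exact ((contDiff_star h1).mul contDiff_const).mul hR
  have hγu : ∀ y, γ y ∈ unitary (H →L[ℂ] H) := fun y =>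
    mul_mem (mul_mem (Unitary.star_mem (hRu _)) (Unitary.star_mem hu)) (hRu y)
  have hstar : ∀ k, star (P k) = P k := fun k => (hproj k).isSelfAdjoint.star_eq
  have hu1 := Unitary.mem_iff.mp hu
  have h1 : ∀ y, star u * P y = P (y - l) * star u := by
    intro y
    have h2 := hl (y - l)
    rw [sub_add_cancel] at h2
    rw [h2, ← mul_assoc, ← mul_assoc, hu1.1, one_mul]
  have h2 : ∀ y, star (R y) * P y = P 0 * star (R y) := by
    intro y
    have h3 := congrArg star (hRP y)
    rw [star_mul, star_mul, hstar, hstar] at h3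
    exact h3.symm
  have hγc : ∀ y, Commute (γ y) (P 0) := by
    intro y
    rw [commute_iff_eq]
    calc γ y * P 0 = star (R (y - l)) * star u * (R y * P 0) := by rw [hγ, mul_assoc]
      _ = star (R (y - l)) * (star u * P y) * R y := by rw [hRP]; simp only [mul_assoc]
      _ = (star (R (y - l)) * P (y - l)) * star u * R y := by rw [h1]; simp only [mul_assoc]
      _ = P 0 * γ y := by rw [h2, hγ]; simp only [mul_assoc]
  obtain ⟨g, hgs, hgu, hgc, hg0, hg1⟩ :=
    exists_smooth_unitary_path_on_range (hproj 0) (hγu l) (hγc l)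
  have hstarc : Commute (star (γ l)) (P 0) := by
    have := (hγc l).star_star
    rwa [hstar] at this
  -- The factor `γ (l + t (y - l)) γ(l)*` contracts `γ` along segments to its value at `l`,
  -- normalised to `1` at time `0`; the path `g` restores the missing factor `γ l` on the range of
  -- `P 0`.
  refine ⟨fun p => γ (l + p.1 • (p.2 - l)) * star (γ l) * g p.1, ?_, fun p => ?_, fun p => ?_,
    fun y => ?_, fun y => ?_⟩
  · have h3 : ContDiff ℝ ∞ (fun p : ℝ × V => l + p.1 • (p.2 - l)) := by fun_prop
    exact ((hγs.comp h3).mul contDiff_const).mul (hgs.comp contDiff_fst)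
  · exact mul_mem (mul_mem (hγu _) (Unitary.star_mem (hγu _))) (hgu _)
  · exact ((hγc _).mul_left hstarc).mul_left (hgc _)
  · simp only [zero_smul, add_zero, hg0, mul_one]
    exact (Unitary.mem_iff.mp (hγu l)).2
  · have h3 := (Unitary.mem_iff.mp (hRu (y - l))).2
    have h4 := (Unitary.mem_iff.mp (hγu l)).1
    simp only [one_smul, add_sub_cancel]
    calc u * R (y - l) * (γ y * star (γ l) * g 1) * P 0
        = u * R (y - l) * γ y * star (γ l) * (g 1 * P 0) := by simp only [mul_assoc]
      _ = u * R (y - l) * γ y * (star (γ l) * γ l) * P 0 := by rw [hg1]; simp only [mul_assoc]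
      _ = u * (R (y - l) * star (R (y - l))) * star u * R y * P 0 := by
        rw [h4, mul_one, hγ]; simp only [mul_assoc]
      _ = R y * P 0 := by rw [h3, mul_one, hu1.2, one_mul]

end Transition

/-! ### The unit cell, the lattice and the distance to the singular set. -/

section Cell

variable {d : ℕ} (b : Basis (Fin d) ℝ (Momentum d))

/-- The coordinate functionals of a basis. -/
noncomputable def coordL (i : Fin d) : Momentum d →L[ℝ] ℝ :=
  LinearMap.toContinuousLinearMap (b.coord i)

lemma coordL_apply (i : Fin d) (k : Momentum d) : coordL b i k = b.repr k i := rfl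

lemma coordL_basis (i j : Fin d) : coordL b i (b j) = if j = i then 1 else 0 := by
  rw [coordL_apply, Basis.repr_self, Finsupp.single_apply]

lemma coordL_sum (f : Fin d → ℝ) (i : Fin d) : coordL b i (∑ j, f j • b j) = f i := by
  rw [map_sum]
  simp [coordL_basis]

lemma ext_coordL {k k' : Momentum d} (h : ∀ i, coordL b i k = coordL b i k') : k = k' :=
  b.ext_elem h

/-- The half-open unit cell. -/
def unitCell : Set (Momentum d) := {y | ∀ i, coordL b i y ∈ Set.Ico (0 : ℝ) 1}

/-- The closed unit cell. -/
def closedCell : Set (Momentum d) := {y | ∀ i, coordL b i y ∈ Set.Icc (0 : ℝ) 1}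

lemma unitCell_subset_closedCell : unitCell b ⊆ closedCell b :=
  fun _ hy i => ⟨(hy i).1, (hy i).2.le⟩

lemma isCompact_closedCell : IsCompact (closedCell b) := by
  have h1 : IsCompact (Set.Icc (0 : Fin d → ℝ) 1) := isCompact_Icc
  convert h1.image b.equivFunL.symm.continuous using 1
  ext y
  constructor
  · intro hy
    refine ⟨b.equivFunL y, ⟨fun i => (hy i).1, fun i => (hy i).2⟩, by simp⟩
  · rintro ⟨f, hf, rfl⟩ i
    have : coordL b i (b.equivFunL.symm f) = f i := by
      have h2 := congrFun (b.equivFunL.apply_symm_apply f) i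
      exact h2
    rw [this]
    exact ⟨hf.1 i, hf.2 i⟩

lemma fract_mem_unitCell (k : Momentum d) : ZSpan.fract b k ∈ unitCell b := fun i => by
  rw [coordL_apply, ZSpan.repr_fract_apply]
  exact ⟨Int.fract_nonneg _, Int.fract_lt_one _⟩

lemma fract_add_floor (k : Momentum d) : ZSpan.fract b k + (ZSpan.floor b k : Momentum d) = k := by
  rw [ZSpan.fract_apply, sub_add_cancel]

lemma fract_add_of_mem_unitCell {y : Momentum d} (hy : y ∈ unitCell b) (l : lattice b) :
    ZSpan.fract b (y + (l : Momentum d)) = y := by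
  rw [ZSpan.fract_add_ZSpan _ _ l.2]
  refine ext_coordL b fun i => ?_
  rw [coordL_apply, ZSpan.repr_fract_apply]
  exact Int.fract_eq_self.mpr (hy i)

lemma floor_add_of_mem_unitCell {y : Momentum d} (hy : y ∈ unitCell b) (l : lattice b) :
    ZSpan.floor b (y + (l : Momentum d)) = l := by
  have h1 := fract_add_floor b (y + (l : Momentum d))
  rw [fract_add_of_mem_unitCell b hy] at h1
  exact Subtype.ext (add_left_cancel h1)

lemma exists_int_coordL (l : lattice b) (i : Fin d) : ∃ n : ℤ, coordL b i (l : Momentum d) = n :=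
  ⟨(b.restrictScalars ℤ).repr l i, by
    rw [coordL_apply, ← Basis.restrictScalars_repr_apply ℤ b l i]; rfl⟩

/-- A basis vector, as a lattice vector. -/
noncomputable def latticeBasis (i : Fin d) : lattice b := ⟨b i, Submodule.subset_span ⟨i, rfl⟩⟩

lemma coe_latticeBasis (i : Fin d) : (latticeBasis b i : Momentum d) = b i := rfl

lemma add_mem_singularSet_iff (k : Momentum d) (l : lattice b) :
    k + (l : Momentum d) ∈ singularSet b ↔ k ∈ singularSet b := by
  have h1 : ∀ i, (∃ p : ℤ, b.repr (k + (l : Momentum d)) i = p) ↔ ∃ p : ℤ, b.repr k i = p := by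
    intro i
    obtain ⟨n, hn⟩ := exists_int_coordL b l i
    rw [coordL_apply] at hn
    rw [map_add, Finsupp.add_apply, hn]
    constructor
    · rintro ⟨p, hp⟩
      exact ⟨p - n, by push_cast; linarith⟩
    · rintro ⟨p, hp⟩
      exact ⟨p + n, by push_cast; linarith⟩
  simp only [singularSet, Set.mem_ofPred_eq, h1]

lemma isClosed_singularSet : IsClosed (singularSet b) := by
  have h1 : ∀ i, IsClosed {k : Momentum d | ∃ p : ℤ, b.repr k i = p} := by
    intro i
    have h2 : {k : Momentum d | ∃ p : ℤ, b.repr k i = p} =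
        coordL b i ⁻¹' Set.range ((↑) : ℤ → ℝ) := by
      ext k
      simp [coordL_apply, eq_comm]
    rw [h2]
    exact Int.isClosedEmbedding_coe_real.isClosed_range.preimage (coordL b i).continuous
  have h3 : singularSet b = ⋃ i : Fin d, ⋃ j : Fin d, ⋃ _ : i ≠ j,
      ({k : Momentum d | ∃ p : ℤ, b.repr k i = p} ∩ {k | ∃ q : ℤ, b.repr k j = q}) := by
    ext k
    simp only [singularSet, Set.mem_ofPred_eq, Set.mem_iUnion, Set.mem_inter_iff, exists_prop]
  rw [h3]
  exact isClosed_iUnion_of_finite fun i => isClosed_iUnion_of_finite fun j =>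
    isClosed_iUnion_of_finite fun _ => (h1 i).inter (h1 j)

open Classical in
/-- The distance to the singular set, truncated at `1`. -/
noncomputable def singDist (k : Momentum d) : ℝ :=
  -- The value `1` for an empty singular set replaces `Metric.infDist`, which would be `0` there.
  if (singularSet b).Nonempty then min 1 (Metric.infDist k (singularSet b)) else 1

lemma singDist_pos {k : Momentum d} (hk : k ∉ singularSet b) : 0 < singDist b k := by
  unfold singDist
  split_ifs with h
  · exact lt_min one_pos (((isClosed_singularSet b).notMem_iff_infDist_pos h).mp hk)
  · exact one_pos

lemma singDist_le_one (k : Momentum d) : singDist b k ≤ 1 := by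
  unfold singDist
  split_ifs with h
  · exact min_le_left _ _
  · exact le_rfl

lemma singDist_le_dist (k : Momentum d) {s : Momentum d} (hs : s ∈ singularSet b) :
    singDist b k ≤ dist k s := by
  rw [singDist, if_pos ⟨s, hs⟩]
  exact (min_le_right _ _).trans (Metric.infDist_le_dist_of_mem hs)

lemma singDist_le_add (k k' : Momentum d) : singDist b k ≤ singDist b k' + dist k k' := by
  unfold singDist
  split_ifs with h
  · rw [← min_add_add_right]
    exact min_le_min (by linarith [dist_nonneg (x := k) (y := k')])
      Metric.infDist_le_infDist_add_dist
  · linarith [dist_nonneg (x := k) (y := k')]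

lemma infDist_add_lattice (k : Momentum d) (l : lattice b) :
    Metric.infDist (k + (l : Momentum d)) (singularSet b) = Metric.infDist k (singularSet b) := by
  rcases (singularSet b).eq_empty_or_nonempty with h | h
  · simp [h]
  have key : ∀ (k : Momentum d) (l : lattice b),
      Metric.infDist (k + (l : Momentum d)) (singularSet b) ≤
        Metric.infDist k (singularSet b) := by
    intro k l
    refine (Metric.le_infDist h).mpr fun {s} hs => ?_
    have h1 := Metric.infDist_le_dist_of_mem (x := k + (l : Momentum d))
      ((add_mem_singularSet_iff b s l).mpr hs)
    rwa [dist_add_right] at h1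
  refine le_antisymm (key k l) ?_
  have h2 := key (k + l) (-l)
  simpa using h2

lemma singDist_add_lattice (k : Momentum d) (l : lattice b) :
    singDist b (k + (l : Momentum d)) = singDist b k := by
  simp only [singDist, infDist_add_lattice]

/-- Periodicity bounds the distance to a nonempty singular set, so truncating it at `1` costs only a
constant factor. -/
lemma exists_infDist_le_mul_singDist :
    ∃ D : ℝ, 0 < D ∧ ∀ k, Metric.infDist k (singularSet b) ≤ D * singDist b k := by
  rcases (singularSet b).eq_empty_or_nonempty with h | ⟨s, hs⟩
  · exact ⟨1, one_pos, fun k => by simp [singDist, h]⟩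
  refine ⟨max 1 (∑ i, ‖b i‖ + ‖s‖), by positivity, fun k => ?_⟩
  have h1 : Metric.infDist k (singularSet b) ≤ ∑ i, ‖b i‖ + ‖s‖ := by
    have h2 := infDist_add_lattice b (ZSpan.fract b k) (ZSpan.floor b k)
    rw [fract_add_floor] at h2
    rw [h2]
    refine (Metric.infDist_le_dist_of_mem hs).trans ?_
    rw [dist_eq_norm]
    exact (norm_sub_le _ _).trans (add_le_add (ZSpan.norm_fract_le b k) le_rfl)
  rw [singDist, if_pos ⟨s, hs⟩]
  rcases le_total 1 (Metric.infDist k (singularSet b)) with h3 | h3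
  · rw [min_eq_left h3, mul_one]
    exact h1.trans (le_max_right _ _)
  · rw [min_eq_right h3]
    exact le_mul_of_one_le_left Metric.infDist_nonneg (le_max_left _ _)

end Cell

/-! ### Cutoffs at the upper faces of the cell. -/

section CellCutoffs

variable {d : ℕ} (b : Basis (Fin d) ℝ (Momentum d))

/-- The open unit cell. -/
def openCell : Set (Momentum d) := {y | ∀ i, coordL b i y ∈ Set.Ioo (0 : ℝ) 1}

lemma isOpen_openCell : IsOpen (openCell b) := by
  have : openCell b = ⋂ i, coordL b i ⁻¹' Set.Ioo (0 : ℝ) 1 := by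
    ext y
    simp only [openCell, Set.mem_iInter, Set.mem_preimage, Set.mem_ofPred_eq]
  rw [this]
  exact isOpen_iInter_of_finite fun i => isOpen_Ioo.preimage (coordL b i).continuous

lemma openCell_subset_unitCell : openCell b ⊆ unitCell b := fun _ hy i => ⟨(hy i).1.le, (hy i).2⟩

/-- The transverse size appearing in the cutoff at the upper face in direction `i`. -/
noncomputable def cutNum (i j : Fin d) (y : Momentum d) : ℝ :=
  -- The entry `1` for `j = i` localises the cutoff at the upper face: that factor vanishes when `1
  -- - yᵢ ≥ 1/4` and equals `1` when `1 - yᵢ ≤ 1/8`.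
  if j = i then 1 else endDist (coordL b j y)

lemma cutNum_self (i : Fin d) (y : Momentum d) : cutNum b i i y = 1 := if_pos rfl

lemma cutNum_of_ne {i j : Fin d} (h : j ≠ i) (y : Momentum d) :
    cutNum b i j y = endDist (coordL b j y) := if_neg h

/-- The cutoffs at the upper faces of the unit cell. -/
noncomputable def cut (y : Momentum d) (i j : Fin d) : ℝ :=
  ratioCutoff (cutNum b i j y / (1 - coordL b i y))

/-- The cutoff at the upper face in direction `i`. -/
noncomputable def cutProd (y : Momentum d) (i : Fin d) : ℝ := ∏ j, cut b y i j

lemma cut_mem_Icc (y : Momentum d) (i j : Fin d) : cut b y i j ∈ Set.Icc (0 : ℝ) 1 :=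
  ⟨ratioCutoff_nonneg _, ratioCutoff_le_one _⟩

variable {b}

lemma cut_eq_zero {y : Momentum d} {i j : Fin d} (hy : coordL b i y < 1)
    (h : cutNum b i j y ≤ 4 * (1 - coordL b i y)) : cut b y i j = 0 :=
  ratioCutoff_of_le ((div_le_iff₀ (by linarith)).mpr h)

lemma cut_eq_one {y : Momentum d} {i j : Fin d} (hy : coordL b i y < 1)
    (h : 8 * (1 - coordL b i y) ≤ cutNum b i j y) : cut b y i j = 1 :=
  ratioCutoff_of_ge ((le_div_iff₀ (by linarith)).mpr h)

lemma cutProd_eq_zero {y : Momentum d} {i : Fin d} (j : Fin d) (hy : coordL b i y < 1)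
    (h : cutNum b i j y ≤ 4 * (1 - coordL b i y)) : cutProd b y i = 0 :=
  Finset.prod_eq_zero (Finset.mem_univ j) (cut_eq_zero hy h)

lemma cutProd_eq_one {y : Momentum d} {i : Fin d} (hy : coordL b i y < 1)
    (h : ∀ j, 8 * (1 - coordL b i y) ≤ cutNum b i j y) : cutProd b y i = 1 :=
  Finset.prod_eq_one fun j _ => cut_eq_one hy (h j)

/-- Nonvanishing of both would give `4 (1 - yᵢ) < 2 (1 - yₗ)` and `4 (1 - yₗ) < 2 (1 - yᵢ)`, which
is impossible for `yᵢ < 1`. -/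
lemma cutProd_disjoint {y : Momentum d} (hy : y ∈ unitCell b) {i l : Fin d} (hil : i ≠ l)
    (hi : cutProd b y i ≠ 0) : cutProd b y l = 0 := by
  by_contra hl
  have h1 : 4 * (1 - coordL b i y) < cutNum b i l y := by
    by_contra! h
    exact hi (cutProd_eq_zero l (hy i).2 h)
  have h2 : 4 * (1 - coordL b l y) < cutNum b l i y := by
    by_contra! h
    exact hl (cutProd_eq_zero i (hy l).2 h)
  rw [cutNum_of_ne b hil.symm] at h1
  rw [cutNum_of_ne b hil] at h2
  have h3 := endDist_le (hy i).2.le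
  have h4 := endDist_le (hy l).2.le
  have h5 := (hy i).2
  linarith

lemma contDiffAt_cutNum (i j : Fin d) (y : Momentum d) : ContDiffAt ℝ ∞ (cutNum b i j) y := by
  unfold cutNum
  split_ifs
  · exact contDiffAt_const
  · exact (contDiff_endDist.comp (coordL b j).contDiff).contDiffAt

lemma contDiffAt_cutRatio (i j : Fin d) {y : Momentum d} (hy : coordL b i y < 1) :
    ContDiffAt ℝ ∞ (fun y => cutNum b i j y / (1 - coordL b i y)) y :=
  (contDiffAt_cutNum i j y).div (contDiffAt_const.sub (coordL b i).contDiff.contDiffAt)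
    (by linarith)

lemma contDiffAt_cut {y : Momentum d} (hy : ∀ i, coordL b i y < 1) :
    ContDiffAt ℝ ∞ (cut b) y :=
  contDiffAt_pi.mpr fun i => contDiffAt_pi.mpr fun j =>
    contDiff_ratioCutoff.contDiffAt.comp y (contDiffAt_cutRatio i j (hy i))

variable (b) in
-- Moving `yᵢ` to `1` and `yⱼ` to the nearer of `0` and `1` reaches the singular set.
lemma singDist_le_of_face : ∃ C : ℝ, 0 < C ∧ ∀ i j : Fin d, i ≠ j → ∀ y ∈ unitCell b,
    singDist b y ≤ C * ((1 - coordL b i y) + endDist (coordL b j y)) := by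
  refine ⟨1 + ∑ i, ‖b i‖, by positivity, fun i j hij y hy => ?_⟩
  have hbi : ∀ i, ‖b i‖ ≤ 1 + ∑ i, ‖b i‖ := fun i => by
    have := Finset.single_le_sum (f := fun i => ‖b i‖) (fun i _ => norm_nonneg _)
      (Finset.mem_univ i)
    linarith
  obtain ⟨p, hp⟩ : ∃ p : ℤ, |(p : ℝ) - coordL b j y| ≤ endDist (coordL b j y) := by
    have h1 := min_le_endDist (coordL b j y)
    rcases min_cases (coordL b j y) (1 - coordL b j y) with ⟨h, _⟩ | ⟨h, _⟩
    · exact ⟨0, by rw [h] at h1; simpa [abs_of_nonneg (hy j).1] using h1⟩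
    · refine ⟨1, ?_⟩
      rw [h] at h1
      rw [Int.cast_one, abs_of_nonneg (by linarith [(hy j).2])]
      exact h1
  set s : Momentum d := y + ((1 - coordL b i y) • b i + ((p : ℝ) - coordL b j y) • b j) with hs
  have hmem : s ∈ singularSet b := by
    refine ⟨i, j, hij, ⟨1, ?_⟩, ⟨p, ?_⟩⟩
    · rw [← coordL_apply, hs, map_add, map_add, map_smul, map_smul, coordL_basis, coordL_basis,
        if_pos rfl, if_neg hij.symm]
      simp
    · rw [← coordL_apply, hs, map_add, map_add, map_smul, map_smul, coordL_basis, coordL_basis,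
        if_pos rfl, if_neg hij]
      simp
  refine (singDist_le_dist b y hmem).trans ?_
  rw [dist_eq_norm, hs, sub_add_cancel_left, norm_neg]
  refine (norm_add_le _ _).trans ?_
  rw [norm_smul, norm_smul, Real.norm_eq_abs, Real.norm_eq_abs,
    abs_of_nonneg (by linarith [(hy i).2] : (0 : ℝ) ≤ 1 - coordL b i y)]
  have h2 := (hy i).2
  calc _ ≤ (1 - coordL b i y) * (1 + ∑ i, ‖b i‖) +
        endDist (coordL b j y) * (1 + ∑ i, ‖b i‖) := by
        gcongr
        · exact hbi i
        · exact (abs_nonneg _).trans hp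
        · exact hbi j
    _ = _ := by ring

variable (b) in
-- A cutoff is locally constant unless its ratio lies in `[4, 8]`. There numerator and denominator
-- are comparable, so the gradient is of order `1 / (1 - yᵢ)`, and `1 - yᵢ` is bounded below by a
-- multiple of the distance to the singular set.
lemma exists_hasFDerivAt_cut : ∃ C : ℝ, 0 ≤ C ∧ ∀ y ∈ openCell b, ∀ i j,
    ∃ L : Momentum d →L[ℝ] ℝ, HasFDerivAt (fun z => cut b z i j) L y ∧
      ‖L‖ ≤ C / singDist b y := by
  obtain ⟨E, hE⟩ := (isCompact_Icc (a := (4 : ℝ)) (b := 8)).exists_bound_of_continuousOn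
    (contDiff_ratioCutoff.continuous_deriv (by simp)).continuousOn
  obtain ⟨Q, hQ⟩ := (isCompact_Icc (a := (0 : ℝ)) (b := 1)).exists_bound_of_continuousOn
    (contDiff_endDist.continuous_deriv (by simp)).continuousOn
  obtain ⟨A, hA0, hA⟩ := singDist_le_of_face b
  set X : ℝ := ∑ i, ‖coordL b i‖ with hX
  have hXi : ∀ i, ‖coordL b i‖ ≤ X := fun i =>
    Finset.single_le_sum (f := fun i => ‖coordL b i‖) (fun i _ => norm_nonneg _)
      (Finset.mem_univ i)
  have hX0 : 0 ≤ X := Finset.sum_nonneg fun i _ => norm_nonneg _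
  have hE0 : 0 ≤ E := (norm_nonneg _).trans (hE 4 (by norm_num))
  have hQ0 : 0 ≤ Q := (norm_nonneg _).trans (hQ 0 (by norm_num))
  refine ⟨E * ((Q * X + 8 * X) * (9 * A + 8)), by positivity, fun y hy i j => ?_⟩
  have hyS : y ∉ singularSet b := by
    rintro ⟨i, _, _, ⟨p, hp⟩, _⟩
    have h1 := hy i
    rw [coordL_apply, hp] at h1
    have h2 : (0 : ℤ) < p := by exact_mod_cast h1.1
    have h3 : p < (1 : ℤ) := by exact_mod_cast h1.2
    omega
  have hδ := singDist_pos b hyS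
  have hδ1 := singDist_le_one b y
  have hi1 := (hy i).2
  set D : ℝ := 1 - coordL b i y with hD
  have hD0 : 0 < D := by linarith
  set r : Momentum d → ℝ := fun z => cutNum b i j z / (1 - coordL b i z) with hr
  have hrc : ContDiffAt ℝ ∞ r y := contDiffAt_cutRatio i j hi1
  have hconst : ∀ c : ℝ, (∀ᶠ z in nhds y, cut b z i j = c) →
      ∃ L : Momentum d →L[ℝ] ℝ, HasFDerivAt (fun z => cut b z i j) L y ∧
        ‖L‖ ≤ E * ((Q * X + 8 * X) * (9 * A + 8)) / singDist b y := by
    intro c hc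
    refine ⟨0, (hasFDerivAt_const c y).congr_of_eventuallyEq hc, ?_⟩
    rw [norm_zero]
    positivity
  rcases lt_or_ge (r y) 4 with h4 | h4
  · refine hconst 0 ?_
    filter_upwards [hrc.continuousAt.eventually (gt_mem_nhds h4)] with z hz
    exact ratioCutoff_of_le hz.le
  rcases lt_or_ge 8 (r y) with h8 | h8
  · refine hconst 1 ?_
    filter_upwards [hrc.continuousAt.eventually (lt_mem_nhds h8)] with z hz
    exact ratioCutoff_of_ge hz.le
  -- the transition region
  obtain ⟨N', hN', hN'b⟩ : ∃ N' : Momentum d →L[ℝ] ℝ, HasFDerivAt (cutNum b i j) N' y ∧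
      ‖N'‖ ≤ Q * X := by
    rcases eq_or_ne j i with h | h
    · have : cutNum b i j = fun _ => (1 : ℝ) := by
        ext z; rw [h, cutNum_self]
      rw [this]
      exact ⟨0, hasFDerivAt_const _ _, by rw [norm_zero]; positivity⟩
    · have h1 : HasDerivAt endDist (deriv endDist (coordL b j y)) (coordL b j y) :=
        (contDiff_endDist.differentiable (by simp) _).hasDerivAt
      have h2 := h1.comp_hasFDerivAt y (coordL b j).hasFDerivAt
      have : cutNum b i j = endDist ∘ (coordL b j) := by
        ext z; rw [cutNum_of_ne b h]; rfl
      rw [this]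
      refine ⟨_, h2, ?_⟩
      rw [norm_smul]
      gcongr
      · exact hQ _ ⟨(hy j).1.le, (hy j).2.le⟩
      · exact hXi j
  have hD' : HasFDerivAt (fun z => 1 - coordL b i z) (-(coordL b i)) y := by
    simpa using (coordL b i).hasFDerivAt.const_sub (1 : ℝ) (x := y)
  have hDinv : HasFDerivAt (fun z => (1 - coordL b i z)⁻¹) (-(D ^ 2)⁻¹ • -(coordL b i)) y :=
    (hasDerivAt_inv hD0.ne').comp_hasFDerivAt y hD'
  have hr' : HasFDerivAt r (cutNum b i j y • (-(D ^ 2)⁻¹ • -(coordL b i)) + D⁻¹ • N') y := by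
    have := hN'.mul hDinv
    exact this
  have hc' := (contDiff_ratioCutoff.differentiable (by simp) (r y)).hasDerivAt.comp_hasFDerivAt y hr'
  have hN : cutNum b i j y = r y * D := by
    exact (div_mul_cancel₀ _ hD0.ne').symm
  -- For `j = i` the ratio bound gives `1 ≤ 8 D`, hence `singDist ≤ 8 D`; for `j ≠ i` the numerator
  -- is at most `8 D`, hence `singDist ≤ A (D + 8 D) = 9 A D`.
  have hDb : D⁻¹ ≤ (9 * A + 8) / singDist b y := by
    rw [inv_le_comm₀ hD0 (by positivity), inv_div, div_le_iff₀ (by positivity)]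
    rcases eq_or_ne j i with h | h
    · have h1 : r y * D = 1 := by rw [← hN, h, cutNum_self]
      nlinarith
    · have h1 := hA i j h.symm y (openCell_subset_unitCell b hy)
      rw [← cutNum_of_ne b h, hN] at h1
      have h2 : r y * D ≤ 8 * D := by gcongr
      nlinarith
  refine ⟨_, hc', ?_⟩
  rw [norm_smul]
  have h9 : ‖cutNum b i j y • (-(D ^ 2)⁻¹ • -(coordL b i)) + D⁻¹ • N'‖ ≤
      (Q * X + 8 * X) * D⁻¹ := by
    have e1 : cutNum b i j y • (-(D ^ 2)⁻¹ • -(coordL b i)) = (r y * D⁻¹) • coordL b i := by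
      rw [hN, smul_smul, smul_neg, ← neg_smul]
      congr 1
      field_simp
    rw [e1]
    refine (norm_add_le _ _).trans ?_
    rw [norm_smul, norm_smul, norm_mul, Real.norm_of_nonneg (by linarith : (0 : ℝ) ≤ r y),
      Real.norm_of_nonneg (by positivity : (0 : ℝ) ≤ D⁻¹)]
    calc r y * D⁻¹ * ‖coordL b i‖ + D⁻¹ * ‖N'‖ ≤ 8 * D⁻¹ * X + D⁻¹ * (Q * X) := by
          gcongr; exact hXi i
      _ = _ := by ring
  calc _ ≤ E * ((Q * X + 8 * X) * D⁻¹) := by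
        gcongr
        exact hE _ ⟨h4, h8⟩
    _ ≤ E * ((Q * X + 8 * X) * ((9 * A + 8) / singDist b y)) := by gcongr
    _ = _ := by ring

end CellCutoffs

section LatticeRepresentations

variable {d : ℕ} {b : Basis (Fin d) ℝ (Momentum d)}
  {H : Type*} [NormedAddCommGroup H] [InnerProductSpace ℂ H] [CompleteSpace H]

lemma LatticeRep.op_mem_unitary (τ : LatticeRep b H) (l : lattice b) :
    τ.op l ∈ unitary (H →L[ℂ] H) :=
  (τ (Multiplicative.ofAdd l)).2

lemma LatticeRep.op_add (τ : LatticeRep b H) (l l' : lattice b) :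
    τ.op (l + l') = τ.op l * τ.op l' := by
  simp [LatticeRep.op, ofAdd_add]

lemma LatticeRep.op_zero (τ : LatticeRep b H) : τ.op 0 = 1 := by
  simp [LatticeRep.op]

lemma IsTauCovariant.add_eq {τ : LatticeRep b H} {P : Momentum d → H →L[ℂ] H}
    (h : IsTauCovariant τ P) (l : lattice b) (k : Momentum d) :
    P (k + (l : Momentum d)) = τ.op l * P k * star (τ.op l) := h k l

end LatticeRepresentations

/-! ### Base points locally constant near the vertices. -/

section StepPoint

variable {d : ℕ} (b : Basis (Fin d) ℝ (Momentum d))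

/-- A smooth map of momentum space which is locally constant near the vertices of the cell. -/
noncomputable def stepPoint (y : Momentum d) : Momentum d :=
  ∑ i, smoothStep (coordL b i y) • b i

lemma contDiff_stepPoint : ContDiff ℝ ∞ (stepPoint b) :=
  ContDiff.sum fun i _ => (contDiff_smoothStep.comp (coordL b i).contDiff).smul contDiff_const

lemma coordL_stepPoint (y : Momentum d) (i : Fin d) :
    coordL b i (stepPoint b y) = smoothStep (coordL b i y) := coordL_sum b _ i

variable {b}

/-- On `[2/3, 4/3]` the step is saturated at `1`, and on the shifted interval `[-1/3, 1/3]` at `0`,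
so the base point follows the translation by `b i`. -/
lemma stepPoint_sub_basis {i : Fin d} {y : Momentum d}
    (hy : coordL b i y ∈ Set.Icc (2 / 3 : ℝ) (4 / 3)) :
    stepPoint b (y - b i) = stepPoint b y - b i := by
  refine ext_coordL b fun j => ?_
  rw [map_sub, coordL_stepPoint, coordL_stepPoint, map_sub, coordL_basis]
  split_ifs with h
  · subst h
    rw [smoothStep_of_le (by linarith [hy.2]), smoothStep_of_ge hy.1, sub_self]
  · rw [sub_zero, sub_zero]

lemma coordL_lattice_of_near {k : Momentum d} {l : lattice b} {i : Fin d}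
    (hk : |coordL b i k| ≤ 1 / 3) (hkl : k - (l : Momentum d) ∈ unitCell b) :
    coordL b i (l : Momentum d) = 0 ∨ coordL b i (l : Momentum d) = -1 := by
  obtain ⟨n, hn⟩ := exists_int_coordL b l i
  have h1 := hkl i
  rw [map_sub, hn] at h1
  rw [hn]
  rw [abs_le] at hk
  have h2 : (n : ℝ) < 1 := by linarith [h1.1]
  have h3 : (-2 : ℝ) < n := by linarith [h1.2]
  have h4 : n < 1 := by exact_mod_cast h2
  have h5 : -2 < n := by exact_mod_cast h3
  have h6 : n = 0 ∨ n = -1 := by omega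
  rcases h6 with rfl | rfl <;> simp

/-- Points near the origin, translated into the cell, lie near the vertex `-l`, which is then their
base point. -/
lemma stepPoint_sub_lattice {k : Momentum d} {l : lattice b}
    (hk : ∀ i, |coordL b i k| ≤ 1 / 3) (hkl : k - (l : Momentum d) ∈ unitCell b) :
    stepPoint b (k - (l : Momentum d)) = -(l : Momentum d) := by
  refine ext_coordL b fun i => ?_
  rw [coordL_stepPoint, map_neg, map_sub]
  have h1 := abs_le.mp (hk i)
  rcases coordL_lattice_of_near (hk i) hkl with h | h
  · rw [h, smoothStep_of_le (by linarith), neg_zero]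
  · rw [h, smoothStep_of_ge (by linarith), neg_neg]

end StepPoint

/-! ### The frame on the cell and its equivariant extension. -/

section FrameOperator

variable {d : ℕ} {b : Basis (Fin d) ℝ (Momentum d)}
  {H : Type*} [NormedAddCommGroup H] [InnerProductSpace ℂ H] [CompleteSpace H]

/-- A frame on the unit cell, with unitaries gluing its opposite faces. The unitaries come with a
smooth homotopy to the identity. -/
structure CellData (τ : LatticeRep b H) (P : Momentum d → H →L[ℂ] H) where
  /-- The frame on the unit cell. -/
  F : Momentum d → H →L[ℂ] H
  /-- Parallel transport along the rays issuing from the origin. -/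
  R : Momentum d → H →L[ℂ] H
  /-- The homotopies from the identity to the transition functions. -/
  Γ : Fin d → ℝ × Momentum d → H →L[ℂ] H
  F_contDiff : ContDiff ℝ ∞ F
  F_unitary : ∀ y, F y ∈ unitary (H →L[ℂ] H)
  F_proj : ∀ y, F y * P 0 = P y * F y
  R_deriv : ∀ k, HasDerivAt (fun s : ℝ => R (s • k)) (katoGenerator P k k * R k) 1
  Γ_contDiff : ∀ i, ContDiff ℝ ∞ (Γ i)
  Γ_unitary : ∀ i p, Γ i p ∈ unitary (H →L[ℂ] H)
  Γ_comm : ∀ i p, Commute (Γ i p) (P 0)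
  Γ_zero : ∀ i y, Γ i (0, y) = 1
  -- The transition depends on `y` only through `stepPoint b y`, hence is locally constant near the
  -- vertices.
  glue : ∀ i y, coordL b i y ∈ Set.Icc (2 / 3 : ℝ) (4 / 3) →
    τ.op (latticeBasis b i) * F (y - b i) * Γ i (1, stepPoint b y) * P 0 = F y * P 0
  -- Near every vertex the translated frame is transport along rays from the origin, composed with a
  -- factor that depends only on the vertex.
  radial : ∀ (k : Momentum d) (l : lattice b), (∀ i, |coordL b i k| ≤ 1 / 3) →
    k - (l : Momentum d) ∈ unitCell b →
    τ.op l * F (k - (l : Momentum d)) = R k * τ.op l * R (-(l : Momentum d))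

theorem exists_cellData {τ : LatticeRep b H} {P : Momentum d → H →L[ℂ] H}
    (hP : ContDiff ℝ ∞ P) (hproj : ∀ k, IsStarProjection (P k))
    [FiniteDimensional ℂ (LinearMap.range (P 0 : H →ₗ[ℂ] H))] (hτ : IsTauCovariant τ P) :
    Nonempty (CellData τ P) := by
  obtain ⟨T, hTs, hT0, hTu, hTP, hTe, hTd⟩ := exists_transport hP hproj
  have hTe' : ∀ (l : lattice b) x v, T (x + (l : Momentum d), v) * τ.op l = τ.op l * T (x, v) :=
    fun l => hTe l (τ.op l) (τ.op_mem_unitary l) (hτ.add_eq l)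
  set R : Momentum d → H →L[ℂ] H := fun y => T (0, y) with hR
  have hRs : ContDiff ℝ ∞ R := hTs.comp (contDiff_const.prodMk contDiff_id)
  have hRP : ∀ y, R y * P 0 = P y * R y := fun y => by
    have := hTP 0 y
    rwa [zero_add] at this
  have htrans : ∀ i, _ := fun i => exists_transition hproj hRs (fun y => hTu _) hRP
    (τ.op_mem_unitary (latticeBasis b i)) (hτ.add_eq (latticeBasis b i))
  choose Γ hΓs hΓu hΓc hΓ0 hΓ1 using htrans
  refine ⟨{
    F := fun y => T (stepPoint b y, y - stepPoint b y) * R (stepPoint b y)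
    R := R
    Γ := Γ
    F_contDiff := ?_
    F_unitary := fun y => mul_mem (hTu _) (hTu _)
    F_proj := fun y => ?_
    R_deriv := fun k => ?_
    Γ_contDiff := hΓs
    Γ_unitary := hΓu
    Γ_comm := hΓc
    Γ_zero := hΓ0
    glue := fun i y hy => ?_
    radial := fun k l hk hkl => ?_ }⟩
  · have h1 := contDiff_stepPoint b
    exact (hTs.comp (h1.prodMk (contDiff_id.sub h1))).mul (hRs.comp h1)
  · rw [mul_assoc, hRP, ← mul_assoc, hTP, add_sub_cancel, mul_assoc]
  · have h1 := hTd 0 ((2 : ℝ) • k) (1 / 2) (by norm_num)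
    have h2 : HasDerivAt (fun s : ℝ => s / 2) (1 / 2) 1 := (hasDerivAt_id (1 : ℝ)).div_const 2
    have h3 := h1.scomp (1 : ℝ) h2
    have e1 : ((fun s : ℝ => T (0, s • (2 : ℝ) • k)) ∘ fun s => s / 2) = fun s => R (s • k) := by
      ext1 s
      simp only [Function.comp_apply, smul_smul, hR]
      rw [div_mul_cancel₀ _ two_ne_zero]
    have e2 : (1 / 2 : ℝ) • (katoGenerator P (0 + (1 / 2 : ℝ) • (2 : ℝ) • k) ((2 : ℝ) • k) *
        T (0, (1 / 2 : ℝ) • (2 : ℝ) • k)) = katoGenerator P k k * R k := by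
      rw [zero_add, smul_smul, katoGenerator_smul, smul_mul_assoc, smul_smul]
      norm_num
      rfl
    rw [e1, e2] at h3
    exact h3
  · have h1 := hTe' (latticeBasis b i) (stepPoint b y - b i) (y - stepPoint b y)
    rw [coe_latticeBasis, sub_add_cancel] at h1
    have h2 := hΓ1 i (stepPoint b y)
    rw [coe_latticeBasis] at h2
    have e : y - b i - (stepPoint b y - b i) = y - stepPoint b y := by abel
    rw [stepPoint_sub_basis hy, e, ← mul_assoc, ← h1]
    simp only [mul_assoc] at h2 ⊢
    rw [h2]
  · rw [stepPoint_sub_lattice hk hkl, sub_neg_eq_add, sub_add_cancel, ← mul_assoc]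
    have h1 := hTe' l (-(l : Momentum d)) k
    rw [neg_add_cancel] at h1
    rw [← h1]

namespace CellData

variable {τ : LatticeRep b H} {P : Momentum d → H →L[ℂ] H} (D : CellData τ P)

/-- The twist on the cell, as a function of the values of the cutoffs. -/
noncomputable def twistAt (c : Fin d → Fin d → ℝ) (y : Momentum d) : H →L[ℂ] H :=
  -- At each point of the cell at most one summand is nonzero when the cutoffs are inserted, so the
  -- sum is a single unitary. The adjoint appears because `glue` places `Γ` on the side of the
  -- translated frame.
  1 + ∑ i, (star (D.Γ i (∏ j, c i j, stepPoint b y)) - 1)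

/-- The twist which makes the frame on the cell match across the faces. -/
noncomputable def twist (y : Momentum d) : H →L[ℂ] H := D.twistAt (cut b y) y

/-- The twisted frame on the unit cell, as an operator on the range of `P 0`. -/
noncomputable def cellOp (y : Momentum d) : H →L[ℂ] H := D.F y * D.twist y * P 0

/-- The equivariant extension of the twisted frame on the unit cell. -/
noncomputable def frameOp (k : Momentum d) : H →L[ℂ] H :=
  τ.op (ZSpan.floor b k) * D.cellOp (ZSpan.fract b k)

lemma twist_eq (y : Momentum d) :
    D.twist y = 1 + ∑ i, (star (D.Γ i (cutProd b y i, stepPoint b y)) - 1) := rfl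

lemma twist_eq_star {y : Momentum d} {i : Fin d} (h : ∀ j ≠ i, cutProd b y j = 0) :
    D.twist y = star (D.Γ i (cutProd b y i, stepPoint b y)) := by
  rw [twist_eq, Finset.sum_eq_single i]
  · abel
  · intro j _ hj
    rw [h j hj, D.Γ_zero, star_one, sub_self]
  · intro h; exact absurd (Finset.mem_univ i) h

lemma twist_eq_one {y : Momentum d} (h : ∀ j, cutProd b y j = 0) : D.twist y = 1 := by
  rw [twist_eq, Finset.sum_eq_zero, add_zero]
  intro j _
  rw [h j, D.Γ_zero, star_one, sub_self]

lemma twist_unitary_comm (hproj : ∀ k, IsStarProjection (P k)) {y : Momentum d}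
    (hy : y ∈ unitCell b) :
    D.twist y ∈ unitary (H →L[ℂ] H) ∧ Commute (D.twist y) (P 0) := by
  by_cases h : ∀ j, cutProd b y j = 0
  · rw [D.twist_eq_one h]
    exact ⟨one_mem _, Commute.one_left _⟩
  · push Not at h
    obtain ⟨i, hi⟩ := h
    rw [D.twist_eq_star (fun j hj => cutProd_disjoint hy hj.symm hi)]
    refine ⟨Unitary.star_mem (D.Γ_unitary _ _), ?_⟩
    have := (D.Γ_comm i (cutProd b y i, stepPoint b y)).star_star
    rwa [(hproj 0).isSelfAdjoint.star_eq] at this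

lemma frameOp_add_of_mem {y : Momentum d} (hy : y ∈ unitCell b) (l : lattice b) :
    D.frameOp (y + (l : Momentum d)) = τ.op l * D.cellOp y := by
  rw [frameOp, floor_add_of_mem_unitCell b hy, fract_add_of_mem_unitCell b hy]

lemma frameOp_of_mem {y : Momentum d} (hy : y ∈ unitCell b) : D.frameOp y = D.cellOp y := by
  have := D.frameOp_add_of_mem hy 0
  simpa [LatticeRep.op_zero] using this

lemma frameOp_add (k : Momentum d) (l : lattice b) :
    D.frameOp (k + (l : Momentum d)) = τ.op l * D.frameOp k := by
  conv_lhs => rw [← fract_add_floor b k, add_assoc, ← Submodule.coe_add]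
  rw [D.frameOp_add_of_mem (fract_mem_unitCell b k), add_comm, τ.op_add, mul_assoc, frameOp]

lemma exists_frameOp_eq (hproj : ∀ k, IsStarProjection (P k)) (hτ : IsTauCovariant τ P)
    (k : Momentum d) :
    ∃ U ∈ unitary (H →L[ℂ] H), D.frameOp k = U * P 0 ∧ U * P 0 = P k * U := by
  set y := ZSpan.fract b k with hy
  set l := ZSpan.floor b k with hl
  have hym := fract_mem_unitCell b k
  obtain ⟨h1, h2⟩ := D.twist_unitary_comm hproj hym
  refine ⟨τ.op l * D.F y * D.twist y, mul_mem (mul_mem (τ.op_mem_unitary l) (D.F_unitary y)) h1,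
    ?_, ?_⟩
  · rw [frameOp, cellOp]
    simp only [mul_assoc, hy, hl]
  · have h3 := hτ.add_eq l y
    rw [hy, hl, fract_add_floor] at h3
    have h4 : P k * τ.op l = τ.op l * P y := by
      rw [h3, mul_assoc, (Unitary.mem_iff.mp (τ.op_mem_unitary _)).1, mul_one]
    rw [mul_assoc, h2.eq, ← mul_assoc, mul_assoc (τ.op l), D.F_proj, ← mul_assoc, ← h4]
    simp only [mul_assoc]
    rfl

end CellData

end FrameOperator

namespace CellData

variable {d : ℕ} {b : Basis (Fin d) ℝ (Momentum d)}
  {H : Type*} [NormedAddCommGroup H] [InnerProductSpace ℂ H] [CompleteSpace H]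
  {τ : LatticeRep b H} {P : Momentum d → H →L[ℂ] H} (D : CellData τ P)

lemma frameOp_eventuallyEq_cellOp {y : Momentum d} (hy : y ∈ openCell b) :
    D.frameOp =ᶠ[nhds y] D.cellOp := by
  filter_upwards [(isOpen_openCell b).mem_nhds hy] with z hz
  exact D.frameOp_of_mem (openCell_subset_unitCell b hz)

/-- Inside the cell, close to the lower face, all cutoffs vanish. On the other side the point is the
translate of one next to the upper face, where the cutoff is `1` and the twist cancels the mismatch.
Both sides give the untwisted frame. -/
lemma frameOp_eventuallyEq_of_face {y : Momentum d} (hy : y ∈ unitCell b) {i : Fin d}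
    (hi : coordL b i y = 0) (hj : ∀ j ≠ i, 0 < coordL b j y) :
    D.frameOp =ᶠ[nhds y] fun z => D.F z * P 0 := by
  have hc : ∀ j, ContinuousAt (coordL b j) y := fun j => (coordL b j).continuous.continuousAt
  have h1 : ∀ᶠ z in nhds y, coordL b i z < 1 / 3 :=
    (hc i).eventually (gt_mem_nhds (by rw [hi]; norm_num))
  have h2 : ∀ᶠ z in nhds y, -(1 / 8) < coordL b i z :=
    (hc i).eventually (lt_mem_nhds (by rw [hi]; norm_num))
  have h3 : ∀ᶠ z in nhds y, ∀ j, j ≠ i → 0 < coordL b j z ∧ coordL b j z < 1 ∧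
      coordL b i z < 4 * (1 - coordL b j z) ∧
      8 * -coordL b i z < endDist (coordL b j z) := by
    rw [Filter.eventually_all]
    intro j
    by_cases hji : j = i
    · exact Filter.Eventually.of_forall fun z h => absurd hji h
    have a1 := (hc j).eventually (lt_mem_nhds (hj j hji))
    have a2 := (hc j).eventually (gt_mem_nhds (hy j).2)
    have a3 : ∀ᶠ z in nhds y, coordL b i z < 4 * (1 - coordL b j z) := by
      refine ((coordL b i).continuous).continuousAt.eventually_lt
        (by have := (coordL b j).continuous; fun_prop) ?_
      rw [hi]
      linarith [(hy j).2]
    have a4 : ∀ᶠ z in nhds y, 8 * -coordL b i z < endDist (coordL b j z) := by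
      refine ContinuousAt.eventually_lt (by have := (coordL b i).continuous; fun_prop)
        (contDiff_endDist.continuous.comp (coordL b j).continuous).continuousAt ?_
      rw [hi]
      simpa using endDist_pos (hj j hji) (hy j).2
    filter_upwards [a1, a2, a3, a4] with z z1 z2 z3 z4 _
    exact ⟨z1, z2, z3, z4⟩
  filter_upwards [h1, h2, h3] with z z1 z2 z3
  rcases le_or_gt 0 (coordL b i z) with hz | hz
  · have hzc : z ∈ unitCell b := by
      intro j
      by_cases hji : j = i
      · rw [hji]; exact ⟨hz, by linarith⟩
      · exact ⟨(z3 j hji).1.le, (z3 j hji).2.1⟩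
    rw [D.frameOp_of_mem hzc, cellOp, D.twist_eq_one, mul_one]
    intro j
    refine cutProd_eq_zero i (hzc j).2 ?_
    by_cases hji : j = i
    · rw [hji, cutNum_self]; linarith
    · rw [cutNum_of_ne b (Ne.symm hji), endDist_of_le z1.le]
      exact (z3 j hji).2.2.1.le
  -- Across the face, `w` is the representative in the cell; it is so close to the upper face that
  -- its cutoff in direction `i` equals `1`.
  · set w := z + b i with hw
    have hwi : coordL b i w = 1 + coordL b i z := by
      rw [hw, map_add, coordL_basis, if_pos rfl, add_comm]
    have hwj : ∀ j ≠ i, coordL b j w = coordL b j z := by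
      intro j hji
      rw [hw, map_add, coordL_basis, if_neg (Ne.symm hji), add_zero]
    have hwc : w ∈ unitCell b := by
      intro j
      by_cases hji : j = i
      · rw [hji, hwi]; constructor <;> linarith
      · rw [hwj j hji]; exact ⟨(z3 j hji).1.le, (z3 j hji).2.1⟩
    have hone : cutProd b w i = 1 := by
      refine cutProd_eq_one (hwc i).2 fun j => ?_
      rw [hwi]
      by_cases hji : j = i
      · rw [hji, cutNum_self]; linarith
      · rw [cutNum_of_ne b hji, hwj j hji]
        have := (z3 j hji).2.2.2
        linarith
    have hzw : z = w + ((-latticeBasis b i : lattice b) : Momentum d) := by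
      rw [Submodule.coe_neg, coe_latticeBasis, hw, add_neg_cancel_right]
    have hwz : w - b i = z := by rw [hw, add_sub_cancel_right]
    have hglue := D.glue i w (by rw [hwi]; constructor <;> linarith)
    rw [hwz] at hglue
    set G := D.Γ i (1, stepPoint b w) with hG
    have hGu := (Unitary.mem_iff.mp (D.Γ_unitary i (1, stepPoint b w))).2
    have htw : D.twist w = star G := by
      rw [D.twist_eq_star (i := i), hone]
      intro j hj
      exact cutProd_disjoint hwc hj.symm (by rw [hone]; exact one_ne_zero)
    have hGc : Commute G (P 0) := D.Γ_comm i _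
    have hop : τ.op (-latticeBasis b i) * τ.op (latticeBasis b i) = 1 := by
      rw [← τ.op_add, neg_add_cancel, τ.op_zero]
    have hcell : D.cellOp w = τ.op (latticeBasis b i) * D.F z * P 0 := by
      have hGc' : star G * P 0 = P 0 * star G := by
        calc star G * P 0 = star G * (P 0 * (G * star G)) := by rw [hGu, mul_one]
          _ = star G * (P 0 * G) * star G := by simp only [mul_assoc]
          _ = (star G * G) * P 0 * star G := by rw [← hGc.eq]; simp only [mul_assoc]
          _ = P 0 * star G := by
            rw [(Unitary.mem_iff.mp (D.Γ_unitary i (1, stepPoint b w))).1, one_mul]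
      rw [cellOp, htw, mul_assoc, hGc', ← mul_assoc, ← hglue, mul_assoc _ G, hGc.eq]
      rw [← mul_assoc, mul_assoc _ G, hGu, mul_one]
    conv_lhs => rw [hzw]
    rw [D.frameOp_add_of_mem hwc, hcell, ← mul_assoc, ← mul_assoc, hop, one_mul]

/-- With the cutoff values as independent variables the frame is smooth up to the boundary of the
cell. All singular behaviour sits in the cutoffs, and the derivatives of this map are bounded on the
compact product of the closed cell and the cube. -/
lemma contDiff_cellOpAt :
    ContDiff ℝ ∞ (fun p : Momentum d × (Fin d → Fin d → ℝ) =>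
      D.F p.1 * D.twistAt p.2 p.1 * P 0) := by
  have h1 : ContDiff ℝ ∞ (fun p : Momentum d × (Fin d → Fin d → ℝ) => D.F p.1) :=
    D.F_contDiff.comp contDiff_fst
  have h2 : ∀ i, ContDiff ℝ ∞ (fun p : Momentum d × (Fin d → Fin d → ℝ) =>
      star (D.Γ i (∏ j, p.2 i j, stepPoint b p.1))) := by
    intro i
    have h3 : ContDiff ℝ ∞ (fun p : Momentum d × (Fin d → Fin d → ℝ) => ∏ j, p.2 i j) :=
      contDiff_prod fun j _ => by fun_prop
    exact (contDiff_clm_apply ((starL' ℝ : (H →L[ℂ] H) ≃L[ℝ] (H →L[ℂ] H)) :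
      (H →L[ℂ] H) →L[ℝ] (H →L[ℂ] H)) ((D.Γ_contDiff i).comp
        (h3.prodMk ((contDiff_stepPoint b).comp contDiff_fst))))
  exact (h1.mul (contDiff_const.add (ContDiff.sum fun i _ => (h2 i).sub contDiff_const))).mul
    contDiff_const

lemma cellOp_eq : D.cellOp = (fun p : Momentum d × (Fin d → Fin d → ℝ) =>
      D.F p.1 * D.twistAt p.2 p.1 * P 0) ∘ fun y => (y, cut b y) := rfl

lemma openCell_or_face {y : Momentum d} (hy : y ∈ unitCell b) (hyS : y ∉ singularSet b) :
    y ∈ openCell b ∨ ∃ i, coordL b i y = 0 ∧ ∀ j ≠ i, 0 < coordL b j y := by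
  by_cases h : ∃ i, coordL b i y = 0
  · obtain ⟨i, hi⟩ := h
    refine Or.inr ⟨i, hi, fun j hj => lt_of_le_of_ne (hy j).1 fun h0 => hyS ?_⟩
    exact ⟨i, j, hj.symm, ⟨0, by rw [← coordL_apply, hi]; simp⟩,
      ⟨0, by rw [← coordL_apply, ← h0]; simp⟩⟩
  · push Not at h
    exact Or.inl fun i => ⟨lt_of_le_of_ne (hy i).1 (h i).symm, (hy i).2⟩

lemma frameOp_eq_translate (l : lattice b) :
    D.frameOp = fun k => τ.op l * D.frameOp (k - (l : Momentum d)) := by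
  ext1 k
  rw [← D.frameOp_add, sub_add_cancel]

lemma contDiffAt_frameOp_of_mem {y : Momentum d} (hy : y ∈ unitCell b)
    (hyS : y ∉ singularSet b) : ContDiffAt ℝ ∞ D.frameOp y := by
  rcases openCell_or_face hy hyS with h | ⟨i, hi, hj⟩
  · refine ContDiffAt.congr_of_eventuallyEq ?_ (D.frameOp_eventuallyEq_cellOp h)
    rw [cellOp_eq]
    exact D.contDiff_cellOpAt.contDiffAt.comp y
      (contDiffAt_id.prodMk (contDiffAt_cut fun i => (hy i).2))
  · refine ContDiffAt.congr_of_eventuallyEq ?_ (D.frameOp_eventuallyEq_of_face hy hi hj)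
    exact (D.F_contDiff.mul contDiff_const).contDiffAt

lemma contDiffAt_frameOp {k : Momentum d} (hk : k ∉ singularSet b) :
    ContDiffAt ℝ ∞ D.frameOp k := by
  set l := ZSpan.floor b k
  rw [D.frameOp_eq_translate l]
  have h1 : ContDiffAt ℝ ∞ D.frameOp (ZSpan.fract b k) := by
    refine D.contDiffAt_frameOp_of_mem (fract_mem_unitCell b k) fun h => hk ?_
    rw [← fract_add_floor b k]
    exact (add_mem_singularSet_iff b _ _).mpr h
  have h2 : ContDiffAt ℝ ∞ (fun k => D.frameOp (k - (l : Momentum d))) k :=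
    ContDiffAt.comp k (by rw [ZSpan.fract_apply] at h1; exact h1)
      (contDiff_id.sub contDiff_const).contDiffAt
  exact contDiffAt_const.mul h2

lemma exists_fderiv_frameOp_le_of_mem : ∃ C : ℝ, 0 ≤ C ∧ ∀ y ∈ unitCell b, y ∉ singularSet b →
    ‖fderiv ℝ D.frameOp y‖ ≤ C / singDist b y := by
  obtain ⟨A, hA0, hA⟩ := exists_hasFDerivAt_cut b
  set M := (fun p : Momentum d × (Fin d → Fin d → ℝ) => D.F p.1 * D.twistAt p.2 p.1 * P 0) with hM
  have hMs : ContDiff ℝ ∞ M := D.contDiff_cellOpAt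
  have hcomp : IsCompact (closedCell b ×ˢ Set.Icc (0 : Fin d → Fin d → ℝ) 1) :=
    (isCompact_closedCell b).prod isCompact_Icc
  obtain ⟨E, hE⟩ := hcomp.exists_bound_of_continuousOn
    (hMs.continuous_fderiv (by simp)).continuousOn
  obtain ⟨G, hG⟩ := (isCompact_closedCell b).exists_bound_of_continuousOn
    ((D.F_contDiff.mul (contDiff_const (c := P 0))).continuous_fderiv (by simp)).continuousOn
  refine ⟨max 0 E * (1 + A) + max 0 G, by positivity, fun y hy hyS => ?_⟩
  have hδ := singDist_pos b hyS
  have hδ1 := singDist_le_one b y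
  rcases openCell_or_face hy hyS with h | ⟨i, hi, hj⟩
  · rw [(D.frameOp_eventuallyEq_cellOp h).fderiv_eq, cellOp_eq]
    choose L hL hLb using hA y h
    have hcut : HasFDerivAt (cut b)
        (ContinuousLinearMap.pi fun i => ContinuousLinearMap.pi fun j => L i j) y :=
      hasFDerivAt_pi.mpr fun i => hasFDerivAt_pi.mpr fun j => hL i j
    have h1 : HasFDerivAt (M ∘ fun y => (y, cut b y)) _ y :=
      (hMs.differentiable (by simp) (y, cut b y)).hasFDerivAt.comp y
        ((hasFDerivAt_id y).prodMk hcut)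
    rw [← hM, h1.fderiv]
    refine (ContinuousLinearMap.opNorm_comp_le _ _).trans ?_
    have h2 : ‖fderiv ℝ M (y, cut b y)‖ ≤ max 0 E := by
      refine (hE _ ⟨unitCell_subset_closedCell b hy, ?_, ?_⟩).trans (le_max_right _ _)
      · exact fun i j => (cut_mem_Icc b y i j).1
      · exact fun i j => (cut_mem_Icc b y i j).2
    have h3 : ‖(ContinuousLinearMap.id ℝ (Momentum d)).prod
        (ContinuousLinearMap.pi fun i => ContinuousLinearMap.pi fun j => L i j)‖ ≤
        (1 + A) / singDist b y := by
      have h1le : 1 ≤ 1 / singDist b y := (one_le_div hδ).mpr hδ1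
      have hAle : 0 ≤ A / singDist b y := by positivity
      refine ContinuousLinearMap.opNorm_le_bound _ (by positivity) fun v => ?_
      rw [ContinuousLinearMap.prod_apply, Prod.norm_def, max_le_iff]
      constructor
      · simp only [ContinuousLinearMap.id_apply]
        refine le_mul_of_one_le_left (norm_nonneg v) ?_
        rw [add_div]; linarith
      · refine (pi_norm_le_iff_of_nonneg (by positivity)).mpr fun i =>
          (pi_norm_le_iff_of_nonneg (by positivity)).mpr fun j => ?_
        refine ((L i j).le_opNorm v).trans ?_
        gcongr
        refine (hLb i j).trans ?_
        rw [add_div]; linarith [hδ, (by positivity : 0 ≤ 1 / singDist b y)]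
    calc _ ≤ max 0 E * ((1 + A) / singDist b y) :=
          mul_le_mul h2 h3 (norm_nonneg _) (le_max_left _ _)
      _ = max 0 E * (1 + A) / singDist b y := by ring
      _ ≤ _ := by gcongr; exact le_add_of_nonneg_right (le_max_left _ _)
  · rw [(D.frameOp_eventuallyEq_of_face hy hi hj).fderiv_eq]
    calc _ ≤ max 0 G := (hG y (unitCell_subset_closedCell b hy)).trans (le_max_right _ _)
      _ ≤ max 0 G / singDist b y := le_div_self (le_max_left _ _) hδ hδ1
      _ ≤ _ := by gcongr; exact le_add_of_nonneg_left (by positivity)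

lemma exists_fderiv_frameOp_le : ∃ C : ℝ, 0 ≤ C ∧ ∀ k ∉ singularSet b,
    ‖fderiv ℝ D.frameOp k‖ ≤ C / singDist b k := by
  obtain ⟨C, hC0, hC⟩ := D.exists_fderiv_frameOp_le_of_mem
  refine ⟨C, hC0, fun k hk => ?_⟩
  set l := ZSpan.floor b k with hl
  set y := ZSpan.fract b k with hy
  have hyl : k - (l : Momentum d) = y := (ZSpan.fract_apply b k).symm
  have hyS : y ∉ singularSet b := fun h => hk <| by
    rw [← fract_add_floor b k]
    exact (add_mem_singularSet_iff b _ _).mpr h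
  have h1 : HasFDerivAt D.frameOp (fderiv ℝ D.frameOp y) (k - (l : Momentum d)) := by
    rw [hyl]
    exact ((D.contDiffAt_frameOp hyS).differentiableAt (by simp)).hasFDerivAt
  have h2 : HasFDerivAt (fun k => D.frameOp (k - (l : Momentum d))) (fderiv ℝ D.frameOp y) k := by
    have h0 : HasFDerivAt (fun k : Momentum d => k - (l : Momentum d))
        (ContinuousLinearMap.id ℝ (Momentum d)) k := (hasFDerivAt_id k).sub_const _
    exact h1.comp k h0
  have h3 := h2.const_mul (τ.op l)
  rw [← D.frameOp_eq_translate l] at h3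
  rw [h3.fderiv]
  have h4 : singDist b k = singDist b y := by
    rw [← singDist_add_lattice b y l, hy, hl, fract_add_floor]
  rw [h4]
  refine le_trans ?_ (hC y (fract_mem_unitCell b k) hyS)
  refine ContinuousLinearMap.opNorm_le_bound _ (norm_nonneg _) fun v => ?_
  have h5 : ‖τ.op l * fderiv ℝ D.frameOp y v‖ = ‖fderiv ℝ D.frameOp y v‖ :=
    CStarRing.norm_mem_unitary_mul _ (τ.op_mem_unitary l)
  exact h5.le.trans (ContinuousLinearMap.le_opNorm _ _)

/-- Scaling by `t` keeps the signs of the coordinates, hence the lattice translate, and near a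
vertex `endDist` and the distance to an upper face through it both scale by `t`. The ratios, and
with them the twist, are constant along the ray. -/
lemma frameOp_smul {k : Momentum d} {t : ℝ} (ht : 0 < t) (hk : ∀ i, |coordL b i k| ≤ 1 / 8)
    (htk : ∀ i, |coordL b i (t • k)| ≤ 1 / 8) :
    D.frameOp (t • k) = D.R (t • k) * (τ.op (ZSpan.floor b k) *
      D.R (-(ZSpan.floor b k : Momentum d)) * D.twist (ZSpan.fract b k) * P 0) := by
  set l := ZSpan.floor b k with hl
  have hyl : ZSpan.fract b k = k - (l : Momentum d) := ZSpan.fract_apply b k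
  have hy := fract_mem_unitCell b k
  rw [hyl] at hy ⊢
  have hk' : ∀ i, |coordL b i k| ≤ 1 / 3 := fun i => (hk i).trans (by norm_num)
  have htk' : ∀ i, |coordL b i (t • k)| ≤ 1 / 3 := fun i => (htk i).trans (by norm_num)
  have hcoord : ∀ i, coordL b i (t • k) = t * coordL b i k := fun i => by
    rw [map_smul, smul_eq_mul]
  have hz : t • k - (l : Momentum d) ∈ unitCell b := by
    intro i
    have h1 := abs_le.mp (htk i)
    have h2 := hy i
    rw [map_sub] at h2 ⊢
    rcases coordL_lattice_of_near (hk' i) hy with h | h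
    · rw [h, sub_zero] at h2 ⊢
      exact ⟨by rw [hcoord]; exact mul_nonneg ht.le h2.1, by linarith⟩
    · rw [h, sub_neg_eq_add] at h2 ⊢
      have h3 : t * coordL b i k < 0 := mul_neg_of_pos_of_neg ht (by linarith [h2.2])
      rw [← hcoord] at h3
      exact ⟨by linarith, by linarith⟩
  have htwist : D.twist (t • k - (l : Momentum d)) = D.twist (k - (l : Momentum d)) := by
    rw [twist_eq, twist_eq, stepPoint_sub_lattice hk' hy, stepPoint_sub_lattice htk' hz]
    congr 1
    refine Finset.sum_congr rfl fun i _ => ?_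
    have hprod : cutProd b (t • k - (l : Momentum d)) i = cutProd b (k - (l : Momentum d)) i := by
      have h1 := abs_le.mp (htk i)
      have h2 := abs_le.mp (hk i)
      -- If `kᵢ ≥ 0` the point is far from the upper face in direction `i` and the cutoff is `0`. If
      -- `kᵢ < 0` its distance to that face is `-kᵢ ≤ 1/8`, so the factor `j = i` is `1` and the
      -- other factors are homogeneous of degree zero.
      rcases coordL_lattice_of_near (hk' i) hy with h | h
      · rw [cutProd_eq_zero i (hz i).2, cutProd_eq_zero i (hy i).2]
        · rw [cutNum_self, map_sub, h]; linarith
        · rw [cutNum_self, map_sub, h]; linarith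
      · refine Finset.prod_congr rfl fun j _ => ?_
        by_cases hji : j = i
        · rw [hji, cut_eq_one (hz i).2, cut_eq_one (hy i).2]
          · rw [cutNum_self, map_sub, h]; linarith
          · rw [cutNum_self, map_sub, h]; linarith
        · have h3 : cutNum b i j (t • k - (l : Momentum d)) =
              t * cutNum b i j (k - (l : Momentum d)) := by
            rw [cutNum_of_ne b hji, cutNum_of_ne b hji, map_sub, map_sub]
            have h4 := abs_le.mp (htk j)
            have h5 := abs_le.mp (hk j)
            rcases coordL_lattice_of_near (hk' j) hy with h' | h'
            · rw [h', endDist_of_le (by linarith), endDist_of_le (by linarith), hcoord]; ring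
            · rw [h', endDist_of_ge (by linarith), endDist_of_ge (by linarith), hcoord]; ring
          have h6 : 1 - coordL b i (t • k - (l : Momentum d)) =
              t * (1 - coordL b i (k - (l : Momentum d))) := by
            rw [map_sub, map_sub, h, hcoord]; ring
          rw [cut, cut, h3, h6, mul_div_mul_left _ _ ht.ne']
    rw [hprod]
  have h1 := D.frameOp_add_of_mem hz l
  rw [sub_add_cancel] at h1
  rw [h1, cellOp, htwist]
  have h2 := D.radial (t • k) l htk' hz
  simp only [← mul_assoc]
  rw [h2]

lemma exists_fderiv_frameOp_radial : ∃ r : ℝ, 0 < r ∧ ∀ k ∉ singularSet b, ‖k‖ < r →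
    fderiv ℝ D.frameOp k k = katoGenerator P k k * D.frameOp k := by
  have hopen : ∀ᶠ k in nhds (0 : Momentum d), ∀ i, |coordL b i k| < 1 / 8 := by
    rw [Filter.eventually_all]
    intro i
    refine ((coordL b i).continuous.abs.continuousAt).eventually (gt_mem_nhds ?_)
    simp
  obtain ⟨r, hr, hball⟩ := Metric.eventually_nhds_iff.mp hopen
  refine ⟨r, hr, fun k hk hkr => ?_⟩
  have hk8 : ∀ i, |coordL b i k| < 1 / 8 := hball (by simpa using hkr)
  set C := τ.op (ZSpan.floor b k) * D.R (-(ZSpan.floor b k : Momentum d)) *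
    D.twist (ZSpan.fract b k) * P 0 with hC
  have hnear : ∀ᶠ t in nhds (1 : ℝ), ∀ i, |coordL b i (t • k)| < 1 / 8 := by
    rw [Filter.eventually_all]
    intro i
    have hcont : Continuous fun t : ℝ => |coordL b i (t • k)| :=
      ((coordL b i).continuous.comp (continuous_id.smul continuous_const)).abs
    refine hcont.continuousAt.eventually (gt_mem_nhds ?_)
    simp only [one_smul]
    exact hk8 i
  have h1 : (fun t : ℝ => D.frameOp (t • k)) =ᶠ[nhds 1] fun t => D.R (t • k) * C := by
    filter_upwards [hnear, lt_mem_nhds one_pos] with t ht ht0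
    exact D.frameOp_smul ht0 (fun i => (hk8 i).le) (fun i => (ht i).le)
  have h2 : HasDerivAt (fun t : ℝ => D.frameOp (t • k)) (katoGenerator P k k * D.R k * C) 1 :=
    ((D.R_deriv k).mul_const C).congr_of_eventuallyEq h1
  have h3 : HasDerivAt (fun t : ℝ => D.frameOp (t • k)) (fderiv ℝ D.frameOp k k) 1 := by
    have h4 : HasDerivAt (fun t : ℝ => t • k) k 1 := by
      simpa using (hasDerivAt_id (1 : ℝ)).smul_const k
    have h5 : HasFDerivAt D.frameOp (fderiv ℝ D.frameOp k) ((1 : ℝ) • k) := by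
      rw [one_smul]
      exact ((D.contDiffAt_frameOp hk).differentiableAt (by simp)).hasFDerivAt
    exact h5.comp_hasDerivAt (1 : ℝ) h4
  have h6 := h1.self_of_nhds
  simp only [one_smul] at h6
  rw [h3.unique h2, h6, mul_assoc]

end CellData

/-! ### Local integrability of singular weights. -/

section SingularIntegrals

lemma integrableOn_norm_rpow_neg {E : Type*} [NormedAddCommGroup E] [NormedSpace ℝ E]
    [MeasurableSpace E] [BorelSpace E] [FiniteDimensional ℝ E] [Nontrivial E] (μ : Measure E)
    [μ.IsAddHaarMeasure] {p : ℝ} (hp : p < finrank ℝ E) (x : E) (r : ℝ) :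
    IntegrableOn (fun z => ‖z - x‖ ^ (-p)) (Metric.ball x r) μ := by
  have h0 : IntegrableOn (fun z : E => ‖z‖ ^ (-p)) (Metric.ball 0 r) μ := by
    rw [integrableOn_fun_norm_addHaar μ (f := fun y => y ^ (-p))]
    rcases le_or_gt r 0 with hr | hr
    · rw [Set.Ioo_eq_empty (not_lt.mpr hr)]; exact integrableOn_empty
    have h1 : IntegrableOn (fun y : ℝ => y ^ ((finrank ℝ E : ℝ) - 1 - p)) (Set.Ioo 0 r) :=
      (intervalIntegral.integrableOn_Ioo_rpow_iff hr).mpr (by linarith)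
    refine h1.congr_fun (fun y hy => ?_) measurableSet_Ioo
    have hpos : 1 ≤ finrank ℝ E := finrank_pos
    simp only [smul_eq_mul]
    rw [← Real.rpow_natCast, ← Real.rpow_add hy.1, Nat.cast_sub hpos, Nat.cast_one]
    ring_nf
  have h2 := (measurePreserving_sub_right μ x).integrableOn_comp_preimage
    (Homeomorph.subRight x).measurableEmbedding (f := fun z : E => ‖z‖ ^ (-p))
    (s := Metric.ball 0 r)
  have h3 : (fun z => z - x) ⁻¹' Metric.ball 0 r = Metric.ball x r := by
    ext z; simp [dist_eq_norm]
  rw [h3] at h2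
  exact h2.mpr h0

/-- The distance to the nearest integer. -/
noncomputable def intDist (t : ℝ) : ℝ := |t - round t|

lemma intDist_nonneg (t : ℝ) : 0 ≤ intDist t := abs_nonneg _

lemma intDist_pos {t : ℝ} (ht : ∀ n : ℤ, t ≠ n) : 0 < intDist t :=
  abs_pos.mpr (sub_ne_zero.mpr (ht _))

lemma measurable_intDist : Measurable intDist := by
  unfold intDist
  simp only [round_eq]
  fun_prop

lemma integrableOn_intDist_rpow_neg {σ : ℝ} (hσ : σ < 1) (N : ℕ) :
    IntegrableOn (fun t => intDist t ^ (-σ)) (Set.Icc (-N : ℝ) N) := by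
  -- The integer nearest to a point of `[-N, N]` lies in `[-N - 1, N + 1]`, so a finite sum of
  -- single-point singularities dominates.
  have h1 : IntegrableOn (fun t : ℝ => ∑ n ∈ Finset.Icc (-(N : ℤ) - 1) (N + 1),
      ‖t - (n : ℝ)‖ ^ (-σ)) (Set.Icc (-N : ℝ) N) := by
    refine integrable_finsetSum _ fun n hn => ?_
    refine (integrableOn_norm_rpow_neg volume (p := σ) (by simpa using hσ) (n : ℝ)
      (2 * N + 2)).mono_set fun t ht => ?_
    rw [Finset.mem_Icc] at hn
    have h2 : (-(N : ℝ) - 1) ≤ n := by exact_mod_cast hn.1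
    have h3 : (n : ℝ) ≤ N + 1 := by exact_mod_cast hn.2
    rw [Metric.mem_ball, Real.dist_eq, abs_lt]
    constructor <;> linarith [ht.1, ht.2]
  refine Integrable.mono' h1 (measurable_intDist.pow_const _).aestronglyMeasurable ?_
  rw [ae_restrict_iff' measurableSet_Icc]
  refine Filter.Eventually.of_forall fun t ht => ?_
  rw [Real.norm_of_nonneg (Real.rpow_nonneg (intDist_nonneg t) _)]
  have hmem : round t ∈ Finset.Icc (-(N : ℤ) - 1) (N + 1) := by
    have h2 := abs_le.mp (abs_sub_round t)
    rw [Finset.mem_Icc]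
    constructor
    · have h3 : (-(N : ℝ) - 1) ≤ round t := by linarith [ht.1]
      exact_mod_cast h3
    · have h3 : (round t : ℝ) ≤ N + 1 := by linarith [ht.2]
      exact_mod_cast h3
  exact Finset.single_le_sum (f := fun n : ℤ => ‖t - (n : ℝ)‖ ^ (-σ))
    (fun n _ => Real.rpow_nonneg (norm_nonneg _) _) hmem

end SingularIntegrals

section Coordinates

variable {d : ℕ} (b : Basis (Fin d) ℝ (Momentum d))

lemma map_equivFunL_volume : Measure.map b.equivFunL (volume : Measure (Momentum d)) =
    (Measure.map b.equivFunL (volume : Measure (Momentum d))).addHaarScalarFactor volume •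
      (volume : Measure (Fin d → ℝ)) :=
  Measure.isAddLeftInvariant_eq_smul _ _

lemma integrable_prod_coordL {g : Fin d → ℝ → ℝ} (hg : ∀ i, Integrable (g i)) :
    Integrable (fun k : Momentum d => ∏ i, g i (coordL b i k)) := by
  have h1 : Integrable (fun f : Fin d → ℝ => ∏ i, g i (f i)) := Integrable.fintype_prod hg
  have h3 : Integrable (fun f : Fin d → ℝ => ∏ i, g i (f i))
      (Measure.map b.equivFunL (volume : Measure (Momentum d))) := by
    rw [map_equivFunL_volume]
    exact h1.smul_measure_nnreal
  have h4 := (b.equivFunL.toHomeomorph.measurableEmbedding.integrable_map_iff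
    (μ := (volume : Measure (Momentum d)))).mp h3
  exact h4

lemma ae_coordL_ne_int : ∀ᵐ k : Momentum d, ∀ i, ∀ n : ℤ, coordL b i k ≠ n := by
  rw [ae_all_iff]
  intro i
  rw [ae_all_iff]
  intro n
  have h3 : Measure.map b.equivFunL (volume : Measure (Momentum d)) {f | f i = (n : ℝ)} = 0 := by
    rw [map_equivFunL_volume, Measure.smul_apply]
    have h4 : (volume : Measure (Fin d → ℝ)) {f | f i = (n : ℝ)} = 0 :=
      Measure.pi_hyperplane (fun _ : Fin d => (volume : Measure ℝ)) i (n : ℝ)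
    rw [h4, smul_zero]
  have h5 := (b.equivFunL.toHomeomorph.measurableEmbedding.map_apply
    (volume : Measure (Momentum d)) {f | f i = (n : ℝ)}).symm.trans h3
  rw [ae_iff]
  convert h5 using 2
  ext k
  simp only [ne_eq, not_not]
  rfl

lemma ae_notMem_singularSet : ∀ᵐ k : Momentum d, k ∉ singularSet b := by
  filter_upwards [ae_coordL_ne_int b] with k hk
  rintro ⟨i, _, _, ⟨p, hp⟩, _⟩
  exact hk i p hp

/-- A nearest singular point has two integer coordinates, so two of the coordinate distances to `ℤ`
are at most `X` times the distance to it. The power `2σ` then splits into two one-variable powers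
`σ`. -/
lemma exists_singDist_rpow_le {σ : ℝ} (hσ : 0 < σ) : ∃ A : ℝ, 0 ≤ A ∧ ∀ k : Momentum d,
    (∀ i, ∀ n : ℤ, coordL b i k ≠ n) →
    (singDist b k) ^ (-(2 * σ)) ≤ A * (1 + ∑ i, ∑ j ∈ Finset.univ.filter (· ≠ i),
      intDist (coordL b i k) ^ (-σ) * intDist (coordL b j k) ^ (-σ)) := by
  set X : ℝ := 1 + ∑ i, ‖coordL b i‖ with hX
  have hXi : ∀ i, ‖coordL b i‖ ≤ X := fun i => by
    have := Finset.single_le_sum (f := fun i => ‖coordL b i‖) (fun i _ => norm_nonneg _)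
      (Finset.mem_univ i)
    linarith
  have hX1 : 1 ≤ X := le_add_of_nonneg_right (Finset.sum_nonneg fun i _ => norm_nonneg _)
  have hX0 : 0 < X := by linarith
  refine ⟨X ^ (2 * σ), by positivity, fun k hk => ?_⟩
  have hm : ∀ i, 0 < intDist (coordL b i k) := fun i => intDist_pos (hk i)
  set W : ℝ := 1 + ∑ i, ∑ j ∈ Finset.univ.filter (· ≠ i),
      intDist (coordL b i k) ^ (-σ) * intDist (coordL b j k) ^ (-σ) with hW
  have hterm : ∀ i j, 0 ≤ intDist (coordL b i k) ^ (-σ) * intDist (coordL b j k) ^ (-σ) :=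
    fun i j => mul_nonneg (Real.rpow_nonneg (hm i).le _) (Real.rpow_nonneg (hm j).le _)
  have hW1 : 1 ≤ W := le_add_of_nonneg_right
    (Finset.sum_nonneg fun i _ => Finset.sum_nonneg fun j _ => hterm i j)
  have hkS : k ∉ singularSet b := by
    rintro ⟨i, _, _, ⟨p, hp⟩, _⟩
    exact hk i p hp
  have hδ := singDist_pos b hkS
  have hXW : 1 ≤ X ^ (2 * σ) * W :=
    one_le_mul_of_one_le_of_one_le (Real.one_le_rpow hX1 (by positivity)) hW1
  unfold singDist
  split_ifs with hne
  swap
  · rw [Real.one_rpow]; exact hXW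
  rcases min_choice 1 (Metric.infDist k (singularSet b)) with h | h
  · rw [h, Real.one_rpow]; exact hXW
  rw [h]
  obtain ⟨s, hs, hds⟩ := (isClosed_singularSet b).exists_infDist_eq_dist hne k
  rw [hds]
  have hpos : 0 < dist k s := by
    rw [dist_pos]
    rintro rfl
    exact hkS hs
  obtain ⟨i, j, hij, ⟨p, hp⟩, ⟨q, hq⟩⟩ := hs
  have hle : ∀ (i : Fin d) (p : ℤ), b.repr s i = p → intDist (coordL b i k) ≤ X * dist k s := by
    intro i p hp
    calc intDist (coordL b i k) ≤ |coordL b i k - p| := round_le _ _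
      _ = ‖coordL b i (k - s)‖ := by
        rw [map_sub, Real.norm_eq_abs, ← hp, ← coordL_apply]
      _ ≤ ‖coordL b i‖ * ‖k - s‖ := ContinuousLinearMap.le_opNorm _ _
      _ ≤ X * dist k s := by rw [dist_eq_norm]; gcongr; exact hXi i
  have hrp : ∀ (i : Fin d) (p : ℤ), b.repr s i = p →
      (X * dist k s) ^ (-σ) ≤ intDist (coordL b i k) ^ (-σ) := fun i p hp =>
    Real.rpow_le_rpow_of_nonpos (hm i) (hle i p hp) (by linarith)
  have hWij : intDist (coordL b i k) ^ (-σ) * intDist (coordL b j k) ^ (-σ) ≤ W := by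
    have h1 := Finset.single_le_sum (f := fun j =>
      intDist (coordL b i k) ^ (-σ) * intDist (coordL b j k) ^ (-σ))
      (s := Finset.univ.filter (· ≠ i)) (fun j _ => hterm i j)
      (Finset.mem_filter.mpr ⟨Finset.mem_univ j, hij.symm⟩)
    have h2 := Finset.single_le_sum (f := fun i => ∑ j ∈ Finset.univ.filter (· ≠ i),
      intDist (coordL b i k) ^ (-σ) * intDist (coordL b j k) ^ (-σ))
      (fun i _ => Finset.sum_nonneg fun j _ => hterm i j) (Finset.mem_univ i)
    linarith [h1.trans h2]
  have hXd : 0 ≤ (X * dist k s) ^ (-σ) := by positivity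
  calc dist k s ^ (-(2 * σ)) = X ^ (2 * σ) * ((X * dist k s) ^ (-σ) * (X * dist k s) ^ (-σ)) := by
        rw [← Real.rpow_add (by positivity), Real.mul_rpow hX0.le hpos.le, ← mul_assoc,
          ← Real.rpow_add hX0]
        ring_nf
        simp
    _ ≤ X ^ (2 * σ) * (intDist (coordL b i k) ^ (-σ) * intDist (coordL b j k) ^ (-σ)) := by
        refine mul_le_mul_of_nonneg_left ?_ (by positivity)
        exact mul_le_mul (hrp i p hp) (hrp j q hq) hXd (Real.rpow_nonneg (hm i).le _)
    _ ≤ X ^ (2 * σ) * W := by gcongr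

lemma lintegral_singDist_rpow_lt_top {σ : ℝ} (h0 : 0 < σ) (h1 : σ < 1) {K : Set (Momentum d)}
    (hK : IsCompact K) :
    ∫⁻ k in K, ENNReal.ofReal (singDist b k ^ (-(2 * σ))) < ⊤ := by
  obtain ⟨A, hA0, hA⟩ := exists_singDist_rpow_le b h0
  obtain ⟨N, hN⟩ : ∃ N : ℕ, ∀ k ∈ K, ∀ i, |coordL b i k| ≤ N := by
    have h2 : ∀ i, ∃ C, ∀ k ∈ K, ‖coordL b i k‖ ≤ C := fun i =>
      hK.exists_bound_of_continuousOn (coordL b i).continuous.continuousOn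
    choose C hC using h2
    obtain ⟨N, hN⟩ := exists_nat_ge (∑ i, |C i|)
    refine ⟨N, fun k hk i => (hC i k hk).trans ((le_abs_self _).trans (le_trans ?_ hN))⟩
    exact Finset.single_le_sum (f := fun i => |C i|) (fun i _ => abs_nonneg _) (Finset.mem_univ i)
  -- The indicators restrict to a box containing `K` and make each term a product of integrable
  -- one-variable functions, with factor `1` in the directions other than `i` and `j`.
  set g : Fin d → Fin d → Fin d → ℝ → ℝ := fun i j l => Set.indicator (Set.Icc (-N : ℝ) N)
    (fun t => if l = i ∨ l = j then intDist t ^ (-σ) else 1) with hg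
  have hgi : ∀ i j l, Integrable (g i j l) := by
    intro i j l
    rw [hg]
    refine (integrable_indicator_iff measurableSet_Icc).mpr ?_
    split_ifs
    · exact integrableOn_intDist_rpow_neg h1 N
    · exact integrableOn_const (by simp)
  have hint : IntegrableOn (fun k : Momentum d => A * (1 + ∑ i, ∑ j ∈ Finset.univ.filter (· ≠ i),
      ∏ l, g i j l (coordL b l k))) K := by
    refine Integrable.const_mul (Integrable.add ?_ ?_) A
    · exact integrableOn_const hK.measure_lt_top.ne
    · exact integrable_finsetSum _ fun i _ => integrable_finsetSum _ fun j _ =>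
        (integrable_prod_coordL b (hgi i j)).integrableOn
  refine lt_of_le_of_lt ?_ hint.lintegral_lt_top
  refine lintegral_mono_ae ?_
  filter_upwards [ae_restrict_mem hK.measurableSet, ae_restrict_of_ae (ae_coordL_ne_int b)]
    with k hkK hk
  refine ENNReal.ofReal_le_ofReal ((hA k hk).trans (le_of_eq ?_))
  congr 2
  refine Finset.sum_congr rfl fun i _ => Finset.sum_congr rfl fun j hj => ?_
  have hij : j ≠ i := (Finset.mem_filter.mp hj).2
  have hval : ∀ l, g i j l (coordL b l k) =
      if l = i ∨ l = j then intDist (coordL b l k) ^ (-σ) else 1 := fun l =>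
    Set.indicator_of_mem (s := Set.Icc (-N : ℝ) N) (abs_le.mp (hN k hkK l)) _
  simp only [hval]
  rw [Finset.prod_ite, Finset.prod_const_one, mul_one]
  have hfil : Finset.univ.filter (fun l => l = i ∨ l = j) = {i, j} := by
    ext l; simp
  rw [hfil, Finset.prod_pair hij.symm]

end Coordinates

/-! ### Fractional Sobolev regularity. -/

section Sobolev

variable {d : ℕ} (b : Basis (Fin d) ℝ (Momentum d))
  {H : Type*} [NormedAddCommGroup H] [InnerProductSpace ℂ H]

/-- For `|k - k'|` below half the distance to the singular set the mean value inequality gives a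
Lipschitz bound, weakened to the exponent `σ ≤ 1`; otherwise the trivial bound `2` suffices. -/
lemma norm_sub_le_rpow_of_fderiv_le {u : Momentum d → H} (hu : ∀ k, ‖u k‖ ≤ 1)
    (hd : ∀ k ∉ singularSet b, DifferentiableAt ℝ u k) {C : ℝ} (hC0 : 0 ≤ C)
    (hC : ∀ k ∉ singularSet b, ‖fderiv ℝ u k‖ ≤ C / singDist b k) {σ : ℝ} (h0 : 0 < σ)
    (h1 : σ ≤ 1) {k : Momentum d} (hk : k ∉ singularSet b) (k' : Momentum d) :
    ‖u k - u k'‖ ≤ (C + 2) * (2 * ‖k - k'‖ / singDist b k) ^ σ := by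
  have hδ := singDist_pos b hk
  set t : ℝ := 2 * ‖k - k'‖ / singDist b k with ht
  have ht0 : 0 ≤ t := by positivity
  rcases lt_or_ge t 1 with h | h
  · have hlt : ‖k - k'‖ < singDist b k / 2 := by
      rw [ht, div_lt_one hδ] at h; linarith
    have hball : ∀ x ∈ Metric.ball k (singDist b k / 2), singDist b k / 2 ≤ singDist b x ∧
        x ∉ singularSet b := by
      intro x hx
      rw [Metric.mem_ball, dist_comm] at hx
      have h2 := singDist_le_add b k x
      refine ⟨by linarith, fun hxS => ?_⟩
      have h3 := singDist_le_dist b k hxS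
      linarith
    have h2 := (convex_ball k (singDist b k / 2)).norm_image_sub_le_of_norm_fderiv_le
      (f := u) (𝕜 := ℝ) (C := 2 * C / singDist b k) (x := k') (y := k)
      (fun x hx => hd x (hball x hx).2)
      (fun x hx => (hC x (hball x hx).2).trans ?_) ?_ (Metric.mem_ball_self (by positivity))
    · calc ‖u k - u k'‖ ≤ 2 * C / singDist b k * ‖k - k'‖ := h2
        _ = C * t := by rw [ht]; ring
        _ ≤ (C + 2) * t ^ σ := by
          refine mul_le_mul (by linarith) ?_ ht0 (by linarith)
          rcases ht0.eq_or_lt with h3 | h3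
          · rw [← h3, Real.zero_rpow h0.ne']
          · calc t = t ^ (1 : ℝ) := (Real.rpow_one t).symm
              _ ≤ t ^ σ := Real.rpow_le_rpow_of_exponent_ge h3 h.le h1
    · calc C / singDist b x ≤ C / (singDist b k / 2) := by
            gcongr; exact (hball x hx).1
        _ = _ := by field_simp
    · rw [Metric.mem_ball, dist_comm, dist_eq_norm]; exact hlt
  · calc ‖u k - u k'‖ ≤ 1 + 1 := (norm_sub_le _ _).trans (add_le_add (hu k) (hu k'))
      _ ≤ (C + 2) * 1 := by linarith
      _ ≤ (C + 2) * t ^ σ := by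
        gcongr
        exact Real.one_le_rpow h h0.le

/-- Bounded functions whose gradient blows up at most like the inverse distance to the singular
set of codimension two lie in all fractional Sobolev spaces of order less than one. -/
theorem memHsLoc_of_fderiv_le {u : Momentum d → H} (hu : ∀ k, ‖u k‖ ≤ 1)
    (hd : ∀ k ∉ singularSet b, DifferentiableAt ℝ u k) {C : ℝ} (hC0 : 0 ≤ C)
    (hC : ∀ k ∉ singularSet b, ‖fderiv ℝ u k‖ ≤ C / singDist b k) {s : ℝ} (hs : s < 1) :
    MemHsLoc s u := by
  have hmeas : AEStronglyMeasurable u volume := by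
    have h1 : ContinuousOn u (singularSet b)ᶜ := fun k hk =>
      (hd k hk).continuousAt.continuousWithinAt
    have h2 := h1.aestronglyMeasurable (μ := volume) (isClosed_singularSet b).isOpen_compl.measurableSet
    rwa [Measure.restrict_eq_self_of_ae_mem (s := (singularSet b)ᶜ) (ae_notMem_singularSet b)] at h2
  refine ⟨hmeas, fun K hK => ?_, fun hs0 K hK => ?_⟩
  · have : IsFiniteMeasure ((volume : Measure (Momentum d)).restrict K) :=
      ⟨by rw [Measure.restrict_apply_univ]; exact hK.measure_lt_top⟩
    exact MemLp.of_bound hmeas.restrict 1 (Filter.Eventually.of_forall hu)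
  -- The integrability of powers of the norm requires a nontrivial space, so dimension zero is
  -- treated apart.
  rcases Nat.eq_zero_or_pos d with rfl | hdpos
  · have : ∀ k k' : Momentum 0, u k - u k' = 0 := fun k k' => by
      rw [Subsingleton.elim k k', sub_self]
    simp [this]
  have : Nonempty (Fin d) := ⟨⟨0, hdpos⟩⟩
  -- Two strict inequalities are needed: `σ < 1` for the integrability of `singDist ^ (-2σ)`, and `s
  -- < σ` for `p < d`, the integrability of the kernel in `k - k'`.
  set σ : ℝ := (s + 1) / 2 with hσ
  have hσ0 : 0 < σ := by linarith
  have hσ1 : σ < 1 := by linarith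
  set p : ℝ := d + 2 * s - 2 * σ with hp
  have hpd : p < finrank ℝ (Momentum d) := by
    rw [finrank_euclideanSpace, Fintype.card_fin]; linarith
  obtain ⟨r, hr⟩ := hK.isBounded.subset_ball (0 : Momentum d)
  set J : ENNReal := ∫⁻ z in Metric.ball (0 : Momentum d) (2 * r), ENNReal.ofReal (‖z‖ ^ (-p))
    with hJ
  have hJtop : J ≠ ⊤ := by
    have h1 := integrableOn_norm_rpow_neg volume hpd (0 : Momentum d) (2 * r)
    simp only [sub_zero] at h1
    exact h1.lintegral_lt_top.ne
  set A : ℝ := ((C + 2) * 2 ^ σ) ^ 2 with hA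
  have hpoint : ∀ k ∉ singularSet b, ∀ k', ‖u k - u k'‖ ^ 2 / ‖k - k'‖ ^ ((d : ℝ) + 2 * s) ≤
      (A * singDist b k ^ (-(2 * σ))) * ‖k' - k‖ ^ (-p) := by
    intro k hk k'
    have hδ := singDist_pos b hk
    rcases eq_or_ne k k' with rfl | hne
    · simp only [sub_self, norm_zero]
      rw [zero_pow two_ne_zero, zero_div]
      positivity
    have hz : 0 < ‖k - k'‖ := norm_pos_iff.mpr (sub_ne_zero.mpr hne)
    have h2 := norm_sub_le_rpow_of_fderiv_le b hu hd hC0 hC hσ0 hσ1.le hk k'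
    rw [norm_sub_rev k' k]
    have e1 : ∀ x : ℝ, 0 ≤ x → (x ^ σ) ^ 2 = x ^ (2 * σ) := fun x hx => by
      rw [← Real.rpow_mul_natCast hx]; push_cast; ring_nf
    calc ‖u k - u k'‖ ^ 2 / ‖k - k'‖ ^ ((d : ℝ) + 2 * s)
        ≤ ((C + 2) * (2 * ‖k - k'‖ / singDist b k) ^ σ) ^ 2 / ‖k - k'‖ ^ ((d : ℝ) + 2 * s) := by
          gcongr
      _ = A * singDist b k ^ (-(2 * σ)) * (‖k - k'‖ ^ (2 * σ) / ‖k - k'‖ ^ ((d : ℝ) + 2 * s)) := by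
          rw [hA, Real.div_rpow (by positivity) hδ.le, Real.mul_rpow zero_le_two hz.le, mul_pow,
            div_pow, mul_pow, e1 _ hδ.le, e1 ‖k - k'‖ hz.le, mul_pow, Real.rpow_neg hδ.le]
          ring
      _ = _ := by
          rw [← Real.rpow_sub hz, hp]
          ring_nf
  have hinner : ∀ k ∈ K, k ∉ singularSet b →
      (∫⁻ k' in K, ENNReal.ofReal (‖u k - u k'‖ ^ 2 / ‖k - k'‖ ^ ((d : ℝ) + 2 * s))) ≤
        ENNReal.ofReal A * ENNReal.ofReal (singDist b k ^ (-(2 * σ))) * J := by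
    intro k hkK hk
    have hδ := singDist_pos b hk
    have hball : K ⊆ (fun z => z - k) ⁻¹' Metric.ball (0 : Momentum d) (2 * r) := by
      intro x hx
      have h1 := hr hx
      have h2 := hr hkK
      rw [mem_ball_zero_iff] at h1 h2
      rw [Set.mem_preimage, mem_ball_zero_iff]
      exact (norm_sub_le _ _).trans_lt (by linarith)
    calc _ ≤ ∫⁻ k' in K, ENNReal.ofReal (A * singDist b k ^ (-(2 * σ))) *
          ENNReal.ofReal (‖k' - k‖ ^ (-p)) := by
          refine lintegral_mono fun k' => ?_
          rw [← ENNReal.ofReal_mul (by positivity)]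
          exact ENNReal.ofReal_le_ofReal (hpoint k hk k')
      _ = ENNReal.ofReal (A * singDist b k ^ (-(2 * σ))) *
          ∫⁻ k' in K, ENNReal.ofReal (‖k' - k‖ ^ (-p)) :=
          lintegral_const_mul' _ _ ENNReal.ofReal_ne_top
      _ ≤ ENNReal.ofReal (A * singDist b k ^ (-(2 * σ))) *
          ∫⁻ k' in (fun z => z - k) ⁻¹' Metric.ball (0 : Momentum d) (2 * r),
            ENNReal.ofReal (‖k' - k‖ ^ (-p)) := by
          gcongr
      _ = _ := by
          rw [(measurePreserving_sub_right volume k).setLIntegral_comp_preimage_emb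
            (Homeomorph.subRight k).measurableEmbedding (fun z => ENNReal.ofReal (‖z‖ ^ (-p))),
            ENNReal.ofReal_mul (by positivity)]
  calc _ ≤ ∫⁻ k in K, ENNReal.ofReal A * ENNReal.ofReal (singDist b k ^ (-(2 * σ))) * J := by
        refine lintegral_mono_ae ?_
        filter_upwards [ae_restrict_mem hK.measurableSet,
          ae_restrict_of_ae (ae_notMem_singularSet b)] with k hkK hk
        exact hinner k hkK hk
    _ = ENNReal.ofReal A * (∫⁻ k in K, ENNReal.ofReal (singDist b k ^ (-(2 * σ)))) * J := by
        rw [lintegral_mul_const' _ _ hJtop, lintegral_const_mul' _ _ ENNReal.ofReal_ne_top]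
    _ < ⊤ := ENNReal.mul_lt_top (ENNReal.mul_lt_top ENNReal.ofReal_lt_top
        (lintegral_singDist_rpow_lt_top b hσ0 hσ1 hK)) hJtop.lt_top

end Sobolev

/-! ### Bloch frames from the frame operator. -/

section Frames

variable {d : ℕ} {b : Basis (Fin d) ℝ (Momentum d)}
  {H : Type*} [NormedAddCommGroup H] [InnerProductSpace ℂ H] [CompleteSpace H]

/-- Equivariant Bloch frames with singularities of codimension two. -/
theorem exists_equivariant_blochFrame {P : Momentum d → H →L[ℂ] H}
    (hP : ContDiff ℝ ∞ P) (hproj : ∀ k, IsStarProjection (P k)) {m : ℕ} (hm : 1 ≤ m)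
    (hrank : finrank ℂ (LinearMap.range (P 0 : H →ₗ[ℂ] H)) = m) {τ : LatticeRep b H}
    (hτ : IsTauCovariant τ P) :
    ∃ Φ : Momentum d → Fin m → H, IsGlobalBlochFrame P Φ ∧ IsTauEquivariant τ Φ ∧
      (∀ s : ℝ, 0 ≤ s → s < 1 → ∀ a : Fin m, MemHsLoc s (fun k => Φ k a)) ∧
      HasCodimTwoSingularities b P Φ := by
  have hfin : FiniteDimensional ℂ (LinearMap.range (P 0 : H →ₗ[ℂ] H)) :=
    FiniteDimensional.of_finrank_pos (by omega)
  obtain ⟨D⟩ := exists_cellData hP hproj hτ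
  obtain ⟨C, hC0, hC⟩ := D.exists_fderiv_frameOp_le
  obtain ⟨r, hr0, hr⟩ := D.exists_fderiv_frameOp_radial
  set e := (stdOrthonormalBasis ℂ (LinearMap.range (P 0 : H →ₗ[ℂ] H))).reindex
    (finCongr hrank) with he
  set w : Fin m → H := fun a => (e a : H) with hw
  have hworth : Orthonormal ℂ w := e.orthonormal.comp_linearIsometry (Submodule.subtypeₗᵢ _)
  have hwspan : Submodule.span ℂ (Set.range w) = LinearMap.range (P 0 : H →ₗ[ℂ] H) := by
    have h1 : Set.range w = (LinearMap.range (P 0 : H →ₗ[ℂ] H)).subtype '' Set.range e := by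
      rw [← Set.range_comp]; rfl
    rw [h1, Submodule.span_image, ← e.coe_toBasis, e.toBasis.span_eq, Submodule.map_top,
      Submodule.range_subtype]
  have hPw : ∀ a, P 0 (w a) = w a := by
    intro a
    obtain ⟨x, hx⟩ := (e a).2
    have h1 : P 0 * P 0 = P 0 := (hproj 0).isIdempotentElem
    have h2 : P 0 (P 0 x) = P 0 x := congrArg (fun L : H →L[ℂ] H => L x) h1
    have h3 : w a = P 0 x := hx.symm
    rw [h3, h2]
  set Φ : Momentum d → Fin m → H := fun k a => D.frameOp k (w a) with hΦ
  have hU := D.exists_frameOp_eq hproj hτ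
  have hΦU : ∀ k, ∃ U ∈ unitary (H →L[ℂ] H), (∀ a, Φ k a = U (w a)) ∧ U * P 0 = P k * U := by
    intro k
    obtain ⟨U, hUu, hUe, hUP⟩ := hU k
    refine ⟨U, hUu, fun a => ?_, hUP⟩
    rw [hΦ]
    simp only
    rw [hUe, mul_apply_eq_comp, hPw]
  have horth : ∀ k, Orthonormal ℂ (Φ k) := by
    intro k
    obtain ⟨U, hUu, hUe, -⟩ := hΦU k
    have h1 : Φ k = fun a => U (w a) := funext hUe
    rw [h1]
    exact hworth.comp_linearIsometry (Unitary.linearIsometryEquiv ⟨U, hUu⟩).toLinearIsometry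
  have hspan : ∀ k, Submodule.span ℂ (Set.range (Φ k)) =
      LinearMap.range (P k : H →ₗ[ℂ] H) := by
    intro k
    obtain ⟨U, hUu, hUe, hUP⟩ := hΦU k
    have h1 : Set.range (Φ k) = (U : H →ₗ[ℂ] H) '' Set.range w := by
      rw [← Set.range_comp]; congr 1; exact funext hUe
    rw [h1, Submodule.span_image, hwspan, ← LinearMap.range_comp]
    have h2 : (U : H →ₗ[ℂ] H) ∘ₗ (P 0 : H →ₗ[ℂ] H) = (P k : H →ₗ[ℂ] H) ∘ₗ (U : H →ₗ[ℂ] H) := by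
      ext x
      exact congrArg (fun L : H →L[ℂ] H => L x) hUP
    rw [h2, LinearMap.range_comp_of_range_eq_top]
    rw [LinearMap.range_eq_top]
    intro x
    exact ⟨star U x, congrArg (fun L : H →L[ℂ] H => L x) (Unitary.mem_iff.mp hUu).2⟩
  have hPΦ : ∀ k a, P k (Φ k a) = Φ k a := by
    intro k a
    obtain ⟨U, hUu, hUe, hUP⟩ := hΦU k
    have h1 := congrArg (fun L : H →L[ℂ] H => L (w a)) hUP
    simp only [mul_apply_eq_comp, hPw] at h1
    rw [hUe, ← h1]
  have hnorm : ∀ k a, ‖Φ k a‖ ≤ 1 := fun k a => ((horth k).1 a).le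
  have hderiv : ∀ k ∉ singularSet b, ∀ a, HasFDerivAt (fun k => Φ k a)
      (((ContinuousLinearMap.apply ℂ H (w a)).restrictScalars ℝ).comp (fderiv ℝ D.frameOp k)) k := by
    intro k hk a
    have h1 := ((D.contDiffAt_frameOp hk).differentiableAt (by simp)).hasFDerivAt
    exact ((ContinuousLinearMap.apply ℂ H (w a)).restrictScalars ℝ).hasFDerivAt.comp k h1
  have hbound : ∀ k ∉ singularSet b, ∀ a, ‖fderiv ℝ (fun k => Φ k a) k‖ ≤ C / singDist b k := by
    intro k hk a
    rw [(hderiv k hk a).fderiv]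
    have hδ := singDist_pos b hk
    refine ContinuousLinearMap.opNorm_le_bound _ (by positivity) fun v => ?_
    calc ‖fderiv ℝ D.frameOp k v (w a)‖ ≤ ‖fderiv ℝ D.frameOp k v‖ * ‖w a‖ :=
          ContinuousLinearMap.le_opNorm _ _
      _ = ‖fderiv ℝ D.frameOp k v‖ := by rw [hworth.1 a, mul_one]
      _ ≤ ‖fderiv ℝ D.frameOp k‖ * ‖v‖ := ContinuousLinearMap.le_opNorm _ _
      _ ≤ C / singDist b k * ‖v‖ := by gcongr; exact hC k hk
  refine ⟨Φ, Filter.Eventually.of_forall fun k => ⟨horth k, hspan k⟩, fun k l a => ?_,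
    fun s _ hs a => memHsLoc_of_fderiv_le b (fun k => hnorm k a)
      (fun k hk => (hderiv k hk a).differentiableAt) hC0 (fun k hk => hbound k hk a) hs,
    fun a => ?_, fun hd2 => ?_, fun _ => ⟨r, hr0, fun k hk hkr a => ?_⟩⟩
  · rw [hΦ]
    simp only
    rw [D.frameOp_add, mul_apply_eq_comp]
  · intro k hk
    refine ContDiffAt.contDiffWithinAt ?_
    exact ((ContinuousLinearMap.apply ℂ H (w a)).restrictScalars ℝ).contDiff.contDiffAt.comp k
      (D.contDiffAt_frameOp hk)
  · obtain ⟨A, hA0, hA⟩ := exists_infDist_le_mul_singDist b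
    have hne : (singularSet b).Nonempty := by
      refine ⟨0, ⟨0, by omega⟩, ⟨1, by omega⟩, by simp, ⟨0, by simp⟩, ⟨0, by simp⟩⟩
    refine ⟨A * C, fun k hk a => (hbound k hk a).trans ?_⟩
    have hpos := ((isClosed_singularSet b).notMem_iff_infDist_pos hne).mp hk
    rw [div_le_div_iff₀ (singDist_pos b hk) hpos]
    nlinarith [hA k]
  -- Since `P Φ = Φ`, the Berry derivative is `P` applied to the radial derivative, which is the
  -- Kato generator applied to `P Φ`; it vanishes because the generator is off-diagonal.
  · have h1 : (fun x => P x (Φ x a)) = fun x => Φ x a := funext fun x => hPΦ x a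
    have h2 : (fun x => (1 - P x) (Φ x a)) = fun _ => 0 := funext fun x => by
      rw [sub_apply, one_apply_eq_self, hPΦ, sub_self]
    rw [berryDeriv, h1, h2, (hderiv k hk a).fderiv]
    have h3 := hr k hk hkr
    have h4 : fderiv ℝ D.frameOp k k (w a) = katoGenerator P k k (P k (Φ k a)) := by
      rw [h3, hPΦ]; rfl
    have h5 := congrArg (fun L : H →L[ℂ] H => L (Φ k a)) (projection_mul_katoGenerator_mul hproj k k)
    have h6 : P k (fderiv ℝ D.frameOp k k (w a)) = 0 := by rw [h4]; exact h5
    simpa using h6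

end Frames

end BlochFrames

theorem mainTheorem3 {d : ℕ} (hd : d ≤ 3)
    (b : Module.Basis (Fin d) ℝ (BlochFrames.Momentum d))
    {H : Type*} [NormedAddCommGroup H] [InnerProductSpace ℂ H] [CompleteSpace H]
    [TopologicalSpace.SeparableSpace H]
    (P : BlochFrames.Momentum d → H →L[ℂ] H)
    (hproj : ∀ k, IsStarProjection (P k))
    (hanalytic : AnalyticOnNhd ℝ P Set.univ)
    {m : ℕ} (hm : 1 ≤ m)
    (hrank : ∀ k, Module.finrank ℂ (LinearMap.range (P k : H →ₗ[ℂ] H)) = m) :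
    (∀ τ : BlochFrames.LatticeRep b H, BlochFrames.IsTauCovariant τ P →
      ∃ Φ : BlochFrames.Momentum d → Fin m → H,
        BlochFrames.IsGlobalBlochFrame P Φ ∧
        BlochFrames.IsTauEquivariant τ Φ ∧
        (∀ s : ℝ, 0 ≤ s → s < 1 → ∀ a : Fin m, BlochFrames.MemHsLoc s (fun k => Φ k a)) ∧
        BlochFrames.HasCodimTwoSingularities b P Φ) ∧
    (BlochFrames.IsLatticePeriodic b P →
      ∃ Φ : BlochFrames.Momentum d → Fin m → H,
        BlochFrames.IsGlobalBlochFrame P Φ ∧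
        BlochFrames.IsLatticePeriodic b Φ ∧
        (∀ s : ℝ, 0 ≤ s → s < 1 → ∀ a : Fin m, BlochFrames.MemHsLoc s (fun k => Φ k a)) ∧
        BlochFrames.HasCodimTwoSingularities b P Φ) := by
  have hP : ContDiff ℝ ∞ P :=
    contDiff_iff_contDiffAt.mpr fun k => (hanalytic k (Set.mem_univ k)).contDiffAt
  refine ⟨fun τ hτ => BlochFrames.exists_equivariant_blochFrame hP hproj hm (hrank 0) hτ,
    fun hper => ?_⟩
  -- Periodicity is covariance under the trivial representation.
  obtain ⟨Φ, h1, h2, h3, h4⟩ := BlochFrames.exists_equivariant_blochFrame hP hproj hm (hrank 0)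
    (τ := (1 : BlochFrames.LatticeRep b H)) (fun k l => by
      rw [hper k l]
      simp [BlochFrames.LatticeRep.op])
  refine ⟨Φ, h1, fun k l => funext fun a => ?_, h3, h4⟩
  rw [h2 k l a]
  simp [BlochFrames.LatticeRep.op]
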